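/- Let $d\ge 0$ and $s>1$. Write $\hat f(\xi)=\int_{\mathbb R^d}e^{-2\pi i x\cdot\xi}f(x)\,dx$, and $|\cdot|$ for the Euclidean norm. Definitions. For $h>0$ and a smooth $f:\mathbb R^d\to\mathbb C$ put $$\|f\|_{\mathcal S_{s,h}}=\sup_{\alpha,\beta\in\mathbb N^d}\ \sup_{x\in\mathbb R^d}\frac{|x^\alpha\partial^\beta f(x)|}{h^{|\alpha+\beta|}(\alpha!\,\beta!)^s}.$$ The Gelfand–Shilov space $\mathcal S_s(\mathbb R^d)$ (resp. $\Sigma_s(\mathbb R^d)$) consists of all $f\in C^\infty(\mathbb R^d)$ with $\|f\|_{\mathcal S_{s,h}}<\infty$ for some $h>0$ (resp. for every $h>0$). The space $\Sigma_1(\mathbb R^d)$ consists of all $f\in C^\infty(\mathbb R^d)$ such that $\sup_x|f(x)|e^{h|x|}<\infty$ and $\sup_\omega|\hat f(\omega)|e^{h|\omega|}<\infty$ for every $h>0$, with the topology given by the sums of these two suprema as seminorms, and $\Sigma_1'(\mathbb R^d)$ is its continuous dual. A locally integrable function $f$ is identified with the element $\varphi\mapsto\int f\varphi\,dx$ of $\Sigma_1'(\mathbb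 R^d)$ (when the integrals converge absolutely and this functional is continuous), and $\hat u(\varphi)=u(\hat\varphi)$ for $u\in\Sigma_1'(\mathbb R^d)$. Fix a window $\phi\in\Sigma_1(\mathbb R^d)\setminus\{0\}$. For $u\in\Sigma_1'(\mathbb R^d)$ let $V_\phi u(x,\xi)=u\big(e^{-2\pi i\xi\cdot(\,\cdot\,)}\,\overline{\phi(\,\cdot\,-x)}\big)$ be its short-time Fourier transform, and for $h\ge 0$ let $$\mathcal{C}oY^{h,s}(\mathbb R^d)=\Big\{u\in\Sigma_1'(\mathbb R^d):\int_{\mathbb R^d}\Big(\int_{\mathbb R^d}|V_\phi u(x,\xi)|^2dx\Big)e^{2h|\xi|^{1/s}}d\xi<\infty\Big\},$$ $$\mathscr F\mathcal{C}oY^{h,s}(\mathbb R^d)=\{u\in\Sigma_1'(\mathbb R^d):\hat u\in\mathcal{C}oY^{h,s}(\mathbb R^d)\}.$$ Theorem. For every such $d$, $s$, $\phi$ and every $f\in\Sigma_1'(\mathbb R^d)$ the following are equivalent: (a) $f\in\mathcal S_s(\mathbb R^d)$ (resp. $f\in\Sigma_s(\mathbb R^d)$), that is, $f$ is given by a function in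 this space; (b) $f$ is given by a function, and for some $h>0$ (resp. for every $h>0$) $$\sup_{x\in\mathbb R^d}|f(x)|e^{h|x|^{1/s}}<\infty\quad\text{and}\quad\sup_{\xi\in\mathbb R^d}|\hat f(\xi)|e^{h|\xi|^{1/s}}<\infty$$ (for a suitable representative of $f$); (c) for some $h>0$ (resp. for every $h>0$), $f\in\mathcal{C}oY^{h,s}(\mathbb R^d)\cap\mathscr F\mathcal{C}oY^{h,s}(\mathbb R^d)$. -/

import Mathlib

open MeasureTheory FourierTransform
open scoped Real ENNReal ContDiff InnerProductSpace

noncomputable section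

/-- The space `ℝ^d` with its Euclidean norm. -/
abbrev Rd (d : ℕ) : Type := EuclideanSpace ℝ (Fin d)

/-! ### The Gelfand-Shilov spaces of Roumieu and Beurling type -/

/-- The partial derivative `∂_i f`. -/
def partialDeriv {d : ℕ} (i : Fin d) (f : Rd d → ℂ) : Rd d → ℂ :=
  fun x => fderiv ℝ f x (EuclideanSpace.single i 1)

/-- The derivative `∂^β f = ∂_1^{β_1} ⋯ ∂_d^{β_d} f` for a multi-index `β`. -/
def multiDeriv {d : ℕ} (β : Fin d → ℕ) (f : Rd d → ℂ) : Rd d → ℂ :=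
  (List.finRange d).foldr (fun i g => (partialDeriv i)^[β i] g) f

/-- `sup_{α, β, x} |x^α ∂^β f(x)| / (h^{|α + β|} (α! β!)^s)`, as an extended real. -/
def gsNorm {d : ℕ} (s h : ℝ) (f : Rd d → ℂ) : ℝ≥0∞ :=
  ⨆ (α : Fin d → ℕ) (β : Fin d → ℕ) (x : Rd d),
    ENNReal.ofReal (‖((∏ i, x i ^ α i : ℝ) : ℂ) * multiDeriv β f x‖ /
      (h ^ (∑ i, (α i + β i)) * (((∏ i, (α i).factorial) * (∏ i, (β i).factorial) : ℕ) : ℝ) ^ s))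

/-- The Gelfand-Shilov space `S_s(ℝ^d)` of Roumieu type. -/
def roumieuGS (d : ℕ) (s : ℝ) : Set (Rd d → ℂ) :=
  {f | ContDiff ℝ ∞ f ∧ ∃ h : ℝ, 0 < h ∧ gsNorm s h f < ⊤}

/-- The Gelfand-Shilov space `Σ_s(ℝ^d)` of Beurling type. -/
def beurlingGS (d : ℕ) (s : ℝ) : Set (Rd d → ℂ) :=
  {f | ContDiff ℝ ∞ f ∧ ∀ h : ℝ, 0 < h → gsNorm s h f < ⊤}

/-! ### Bounds by the weights `e^{-h|x|^{1/s}}` -/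

/-- `sup_x |f(x)| e^{h |x|^{1/s}} < ∞`. -/
def WeightBound {d : ℕ} (s h : ℝ) (f : Rd d → ℂ) : Prop :=
  ∃ C : ℝ, ∀ x, ‖f x‖ * Real.exp (h * ‖x‖ ^ (1 / s)) ≤ C

/-! ### The space `Σ_1(ℝ^d)` and its dual -/

/-- `sup_x |f(x)| e^{h |x|} < ∞`. -/
def ExpBound {d : ℕ} (h : ℝ) (f : Rd d → ℂ) : Prop :=
  ∃ C : ℝ, ∀ x, ‖f x‖ * Real.exp (h * ‖x‖) ≤ C

/-- Membership in `Σ_1(ℝ^d)`: smooth functions that, together with their Fourier transforms,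
decay faster than every exponential. -/
def IsSigma1 {d : ℕ} (f : Rd d → ℂ) : Prop :=
  ContDiff ℝ ∞ f ∧ ∀ h : ℝ, 0 < h → ExpBound h f ∧ ExpBound h (𝓕 f)

theorem ExpBound.integrable_pow {d : ℕ} {f : Rd d → ℂ} (hf : Continuous f)
    (hb : ExpBound 1 f) (n : ℕ) : Integrable (fun v => ‖v‖ ^ n * ‖f v‖) := by
  obtain ⟨C, hC⟩ := hb
  have hint : Integrable (fun v : Rd d => (1 + ‖v‖) ^ (-((d + 1 : ℕ) : ℝ))) := by
    apply integrable_one_add_norm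
    simp
  refine (hint.const_mul (C * ((n + d + 1).factorial * Real.exp 1))).mono'
    (by fun_prop) (Filter.Eventually.of_forall fun v => ?_)
  have h0 : (0 : ℝ) < 1 + ‖v‖ := by positivity
  rw [Real.rpow_neg h0.le, Real.rpow_natCast, ← div_eq_mul_inv, le_div_iff₀ (by positivity)]
  have h1 : (1 + ‖v‖) ^ (n + d + 1) ≤ (n + d + 1).factorial * Real.exp 1 * Real.exp ‖v‖ := by
    have := Real.pow_div_factorial_le_exp (1 + ‖v‖) h0.le (n + d + 1)
    rw [div_le_iff₀ (by positivity), Real.exp_add] at this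
    linarith
  have h2 := hC v
  rw [one_mul] at h2
  rw [Real.norm_of_nonneg (by positivity)]
  calc ‖v‖ ^ n * ‖f v‖ * (1 + ‖v‖) ^ (d + 1)
      ≤ (1 + ‖v‖) ^ n * ‖f v‖ * (1 + ‖v‖) ^ (d + 1) := by
        gcongr
        linarith
    _ = ‖f v‖ * (1 + ‖v‖) ^ (n + d + 1) := by ring
    _ ≤ ‖f v‖ * ((n + d + 1).factorial * Real.exp 1 * Real.exp ‖v‖) := by gcongr
    _ = (‖f v‖ * Real.exp ‖v‖) * ((n + d + 1).factorial * Real.exp 1) := by ring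
    _ ≤ C * ((n + d + 1).factorial * Real.exp 1) := by gcongr

theorem ExpBound.integrable {d : ℕ} {f : Rd d → ℂ} (hf : Continuous f)
    (hb : ExpBound 1 f) : Integrable f := by
  have := hb.integrable_pow hf 0
  simp only [pow_zero, one_mul] at this
  exact (integrable_norm_iff hf.aestronglyMeasurable).1 this

theorem ExpBound.add {d : ℕ} {h : ℝ} {f g : Rd d → ℂ} (hf : ExpBound h f) (hg : ExpBound h g) :
    ExpBound h (f + g) := by
  obtain ⟨C, hC⟩ := hf
  obtain ⟨D, hD⟩ := hg
  refine ⟨C + D, fun x => ?_⟩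
  calc ‖(f + g) x‖ * Real.exp (h * ‖x‖) ≤ (‖f x‖ + ‖g x‖) * Real.exp (h * ‖x‖) := by
        gcongr; exact norm_add_le _ _
    _ ≤ C + D := by rw [add_mul]; exact add_le_add (hC x) (hD x)

theorem ExpBound.const_smul {d : ℕ} {h : ℝ} {f : Rd d → ℂ} (c : ℂ) (hf : ExpBound h f) :
    ExpBound h (c • f) := by
  obtain ⟨C, hC⟩ := hf
  refine ⟨‖c‖ * C, fun x => ?_⟩
  rw [Pi.smul_apply, norm_smul, mul_assoc]
  exact mul_le_mul_of_nonneg_left (hC x) (norm_nonneg c)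

/-- Passing to a function that is dominated by a translate preserves exponential bounds. -/
theorem ExpBound.translate {d : ℕ} {h : ℝ} (hh : 0 < h) {f g : Rd d → ℂ} (a : Rd d)
    (hfg : ∀ x, ‖g x‖ = ‖f (x - a)‖) (hf : ExpBound h f) : ExpBound h g := by
  obtain ⟨C, hC⟩ := hf
  refine ⟨C * Real.exp (h * ‖a‖), fun x => ?_⟩
  have h1 : ‖x‖ ≤ ‖x - a‖ + ‖a‖ := by simpa using norm_add_le (x - a) a
  calc ‖g x‖ * Real.exp (h * ‖x‖)
      ≤ ‖f (x - a)‖ * (Real.exp (h * ‖x - a‖) * Real.exp (h * ‖a‖)) := by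
        rw [hfg, ← Real.exp_add, ← mul_add]
        gcongr
    _ = (‖f (x - a)‖ * Real.exp (h * ‖x - a‖)) * Real.exp (h * ‖a‖) := by ring
    _ ≤ C * Real.exp (h * ‖a‖) := by gcongr; exact hC _

theorem ExpBound.reflect {d : ℕ} {h : ℝ} {f g : Rd d → ℂ}
    (hfg : ∀ x, ‖g x‖ = ‖f (-x)‖) (hf : ExpBound h f) : ExpBound h g := by
  obtain ⟨C, hC⟩ := hf
  refine ⟨C, fun x => ?_⟩
  rw [hfg, ← norm_neg x]
  exact hC (-x)

theorem IsSigma1.integrable {d : ℕ} {f : Rd d → ℂ} (hf : IsSigma1 f) : Integrable f :=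
  (hf.2 1 one_pos).1.integrable hf.1.continuous

theorem IsSigma1.contDiff_fourier {d : ℕ} {f : Rd d → ℂ} (hf : IsSigma1 f) :
    ContDiff ℝ ∞ (𝓕 f) :=
  Real.contDiff_fourier fun n _ => (hf.2 1 one_pos).1.integrable_pow hf.1.continuous n

theorem IsSigma1.fourier_fourier {d : ℕ} {f : Rd d → ℂ} (hf : IsSigma1 f) (x : Rd d) :
    𝓕 (𝓕 f) x = f (-x) := by
  have h := congrFun (hf.1.continuous.fourierInv_fourier_eq hf.integrable
    ((hf.2 1 one_pos).2.integrable hf.contDiff_fourier.continuous)) (-x)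
  rwa [Real.fourierInv_eq_fourier_neg, neg_neg] at h

theorem IsSigma1.fourier {d : ℕ} {f : Rd d → ℂ} (hf : IsSigma1 f) : IsSigma1 (𝓕 f) :=
  ⟨hf.contDiff_fourier, fun h hh => ⟨(hf.2 h hh).2,
    (hf.2 h hh).1.reflect fun x => by rw [hf.fourier_fourier]⟩⟩

theorem fourier_add_of_integrable {d : ℕ} {f g : Rd d → ℂ} (hf : Integrable f)
    (hg : Integrable g) : 𝓕 (f + g) = 𝓕 f + 𝓕 g := by
  ext w
  simp only [Real.fourier_eq, Pi.add_apply, smul_add]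
  exact integral_add ((Real.fourierIntegral_convergent_iff w).2 hf)
    ((Real.fourierIntegral_convergent_iff w).2 hg)

theorem fourier_const_smul' {d : ℕ} (c : ℂ) (f : Rd d → ℂ) : 𝓕 (c • f) = c • 𝓕 f := by
  ext w
  simp only [Real.fourier_eq, Pi.smul_apply]
  rw [← integral_smul]
  congr 1
  ext v
  rw [smul_comm]

theorem IsSigma1.add {d : ℕ} {f g : Rd d → ℂ} (hf : IsSigma1 f) (hg : IsSigma1 g) :
    IsSigma1 (f + g) := by
  refine ⟨hf.1.add hg.1, fun h hh => ⟨(hf.2 h hh).1.add (hg.2 h hh).1, ?_⟩⟩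
  rw [fourier_add_of_integrable hf.integrable hg.integrable]
  exact (hf.2 h hh).2.add (hg.2 h hh).2

theorem IsSigma1.const_smul {d : ℕ} {f : Rd d → ℂ} (c : ℂ) (hf : IsSigma1 f) :
    IsSigma1 (c • f) := by
  refine ⟨hf.1.const_smul c, fun h hh => ⟨(hf.2 h hh).1.const_smul c, ?_⟩⟩
  rw [fourier_const_smul']
  exact (hf.2 h hh).2.const_smul c

theorem IsSigma1.zero {d : ℕ} : IsSigma1 (0 : Rd d → ℂ) := by
  have h0 : 𝓕 (0 : Rd d → ℂ) = 0 := by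
    ext w
    simp [Real.fourier_eq]
  refine ⟨contDiff_const, fun h _ => ⟨⟨0, fun x => by simp⟩, ⟨0, fun x => ?_⟩⟩⟩
  rw [h0]
  simp

/-- `Σ_1(ℝ^d)` as a vector space of functions. -/
def sigma1Submodule (d : ℕ) : Submodule ℂ (Rd d → ℂ) where
  carrier := {f | IsSigma1 f}
  add_mem' hf hg := hf.add hg
  zero_mem' := IsSigma1.zero
  smul_mem' c _ hf := hf.const_smul c

/-- `Σ_1(ℝ^d)`. This is a new type, so that it carries the topology of its seminorms
and not that of pointwise convergence. -/
def Sigma1 (d : ℕ) : Type := sigma1Submodule d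

instance Sigma1.instAddCommGroup (d : ℕ) : AddCommGroup (Sigma1 d) := inferInstanceAs (AddCommGroup (sigma1Submodule d))

instance Sigma1.instModule (d : ℕ) : Module ℂ (Sigma1 d) := inferInstanceAs (Module ℂ (sigma1Submodule d))

/-- The function underlying an element of `Σ_1(ℝ^d)`. -/
def Sigma1.toFun {d : ℕ} (φ : Sigma1 d) : Rd d → ℂ := φ.1

theorem Sigma1.isSigma1 {d : ℕ} (φ : Sigma1 d) : IsSigma1 φ.toFun := φ.2

theorem Sigma1.toFun_add {d : ℕ} (φ ψ : Sigma1 d) : (φ + ψ).toFun = φ.toFun + ψ.toFun := rfl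

theorem Sigma1.toFun_smul {d : ℕ} (c : ℂ) (φ : Sigma1 d) : (c • φ).toFun = c • φ.toFun := rfl

/-- `sup_x |f(x)| e^{h |x|}`. -/
def expSup {d : ℕ} (h : ℝ) (f : Rd d → ℂ) : ℝ := ⨆ x, ‖f x‖ * Real.exp (h * ‖x‖)

theorem ExpBound.bddAbove {d : ℕ} {h : ℝ} {f : Rd d → ℂ} (hf : ExpBound h f) :
    BddAbove (Set.range fun x => ‖f x‖ * Real.exp (h * ‖x‖)) := by
  obtain ⟨C, hC⟩ := hf
  exact ⟨C, by rintro _ ⟨x, rfl⟩; exact hC x⟩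

theorem expSup_add_le {d : ℕ} {h : ℝ} {f g : Rd d → ℂ} (hf : ExpBound h f) (hg : ExpBound h g) :
    expSup h (f + g) ≤ expSup h f + expSup h g := by
  refine ciSup_le fun x => ?_
  calc ‖(f + g) x‖ * Real.exp (h * ‖x‖) ≤ (‖f x‖ + ‖g x‖) * Real.exp (h * ‖x‖) := by
        gcongr; exact norm_add_le _ _
    _ ≤ expSup h f + expSup h g := by
        rw [add_mul]
        exact add_le_add (le_ciSup hf.bddAbove x) (le_ciSup hg.bddAbove x)

theorem expSup_smul {d : ℕ} (h : ℝ) (c : ℂ) (f : Rd d → ℂ) :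
    expSup h (c • f) = ‖c‖ * expSup h f := by
  unfold expSup
  rw [Real.mul_iSup_of_nonneg (norm_nonneg c)]
  simp only [Pi.smul_apply, norm_smul, mul_assoc]

theorem expSup_reflect {d : ℕ} (h : ℝ) {f g : Rd d → ℂ} (hfg : ∀ x, g x = f (-x)) :
    expSup h g = expSup h f := by
  unfold expSup
  refine (Equiv.neg (Rd d)).iSup_congr fun x => ?_
  simp [hfg]

/-- The seminorms `sup_x |f(x)| e^{h |x|} + sup_ω |f̂(ω)| e^{h |ω|}`, `h > 0`, of `Σ_1(ℝ^d)`. -/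
def sigma1Seminorm (d : ℕ) : SeminormFamily ℂ (Sigma1 d) (Set.Ioi (0 : ℝ)) := fun h =>
  Seminorm.of (fun φ => expSup h.1 φ.toFun + expSup h.1 (𝓕 φ.toFun))
    (fun φ ψ => by
      have hφ := φ.isSigma1
      have hψ := ψ.isSigma1
      rw [Sigma1.toFun_add, fourier_add_of_integrable hφ.integrable hψ.integrable]
      have h1 := expSup_add_le (hφ.2 h.1 h.2).1 (hψ.2 h.1 h.2).1
      have h2 := expSup_add_le (hφ.2 h.1 h.2).2 (hψ.2 h.1 h.2).2
      linarith)
    (fun c φ => by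
      rw [Sigma1.toFun_smul, fourier_const_smul', expSup_smul, expSup_smul, mul_add])

/-- The projective limit (Fréchet) topology of `Σ_1(ℝ^d)`. -/
instance Sigma1.instTopologicalSpace (d : ℕ) : TopologicalSpace (Sigma1 d) := (sigma1Seminorm d).moduleFilterBasis.topology

theorem sigma1_withSeminorms (d : ℕ) : WithSeminorms (sigma1Seminorm d) := ⟨rfl⟩

/-- The space `Σ_1'(ℝ^d)`, the continuous dual of `Σ_1(ℝ^d)`. -/
abbrev Sigma1Dual (d : ℕ) : Type := Sigma1 d →L[ℂ] ℂ

/-! ### The Fourier transform on `Σ_1'` -/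

/-- The Fourier transform on `Σ_1(ℝ^d)`. -/
def Sigma1.fourier (d : ℕ) : Sigma1 d →L[ℂ] Sigma1 d where
  toFun φ := ⟨𝓕 φ.toFun, φ.isSigma1.fourier⟩
  map_add' φ ψ := Subtype.ext
    (fourier_add_of_integrable φ.isSigma1.integrable ψ.isSigma1.integrable)
  map_smul' c φ := Subtype.ext (fourier_const_smul' c φ.toFun)
  cont := by
    refine WithSeminorms.continuous_of_isBounded (sigma1_withSeminorms d) (sigma1_withSeminorms d)
      ({ toFun := fun φ => ⟨𝓕 φ.toFun, φ.isSigma1.fourier⟩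
         map_add' := fun φ ψ => Subtype.ext
          (fourier_add_of_integrable φ.isSigma1.integrable ψ.isSigma1.integrable)
         map_smul' := fun c φ => Subtype.ext (fourier_const_smul' c φ.toFun) } :
          Sigma1 d →ₗ[ℂ] Sigma1 d) fun h => ⟨{h}, 1, fun φ => ?_⟩
    rw [Finset.sup_singleton, one_smul]
    change expSup h.1 (𝓕 φ.toFun) + expSup h.1 (𝓕 (𝓕 φ.toFun))
      ≤ expSup h.1 φ.toFun + expSup h.1 (𝓕 φ.toFun)
    rw [expSup_reflect h.1 φ.isSigma1.fourier_fourier, add_comm]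

/-- The Fourier transform `û` of `u ∈ Σ_1'(ℝ^d)`, given by `û(φ) = u(φ̂)`. -/
def Sigma1Dual.fourier {d : ℕ} (u : Sigma1Dual d) : Sigma1Dual d := u.comp (Sigma1.fourier d)

/-! ### The short-time Fourier transform on `Σ_1'` -/

/-- Translation `T_x f(y) = f(y - x)`. -/
def translation {d : ℕ} (x : Rd d) (f : Rd d → ℂ) : Rd d → ℂ := fun y => f (y - x)

/-- Modulation `M_ξ f(y) = e^{2πi ξ·y} f(y)`. -/
def modulation {d : ℕ} (ξ : Rd d) (f : Rd d → ℂ) : Rd d → ℂ :=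
  fun y => Complex.exp (2 * π * Complex.I * (⟪ξ, y⟫_ℝ : ℝ)) * f y

theorem norm_exp_two_pi_I (t : ℝ) : ‖Complex.exp (2 * π * Complex.I * (t : ℝ))‖ = 1 := by
  rw [show (2 * π * Complex.I * (t : ℝ) : ℂ) = ((2 * π * t : ℝ) : ℂ) * Complex.I by
    push_cast; ring]
  exact Complex.norm_exp_ofReal_mul_I _

theorem norm_fourier_translation {d : ℕ} (x : Rd d) (f : Rd d → ℂ) (w : Rd d) :
    ‖𝓕 (translation x f) w‖ = ‖𝓕 f w‖ := by
  have h : 𝓕 (translation x f) w = Complex.exp (2 * π * Complex.I * (-⟪x, w⟫_ℝ : ℝ)) * 𝓕 f w := by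
    rw [Real.fourier_eq', Real.fourier_eq', ← integral_const_mul,
      ← integral_add_right_eq_self _ x]
    congr 1
    ext v
    simp only [translation, add_sub_cancel_right, smul_eq_mul]
    rw [← mul_assoc, ← Complex.exp_add]
    congr 2
    rw [inner_add_left]
    push_cast
    ring
  rw [h, norm_mul, norm_exp_two_pi_I, one_mul]

theorem fourier_modulation {d : ℕ} (ξ : Rd d) (f : Rd d → ℂ) (w : Rd d) :
    𝓕 (modulation ξ f) w = 𝓕 f (w - ξ) := by
  rw [Real.fourier_eq', Real.fourier_eq']
  congr 1
  ext v
  simp only [modulation, smul_eq_mul]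
  rw [← mul_assoc, ← Complex.exp_add]
  congr 2
  rw [inner_sub_right, real_inner_comm ξ v]
  push_cast
  ring

theorem norm_fourier_conj {d : ℕ} (f : Rd d → ℂ) (w : Rd d) :
    ‖𝓕 (fun y => starRingEnd ℂ (f y)) w‖ = ‖𝓕 f (-w)‖ := by
  have h : 𝓕 (fun y => starRingEnd ℂ (f y)) w = starRingEnd ℂ (𝓕 f (-w)) := by
    rw [Real.fourier_eq', Real.fourier_eq', ← integral_conj]
    congr 1
    ext v
    simp only [smul_eq_mul, map_mul, ← Complex.exp_conj, Complex.conj_I, Complex.conj_ofReal,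
      inner_neg_right]
    congr 2
    push_cast
    ring
  rw [h, RCLike.norm_conj]

theorem IsSigma1.translation {d : ℕ} {f : Rd d → ℂ} (x : Rd d) (hf : IsSigma1 f) :
    IsSigma1 (translation x f) :=
  ⟨hf.1.comp (contDiff_id.sub contDiff_const), fun h hh =>
    ⟨(hf.2 h hh).1.translate hh x fun _ => rfl,
      (hf.2 h hh).2.translate hh 0 fun w => by rw [norm_fourier_translation, sub_zero]⟩⟩

theorem IsSigma1.modulation {d : ℕ} {f : Rd d → ℂ} (ξ : Rd d) (hf : IsSigma1 f) :
    IsSigma1 (modulation ξ f) := by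
  refine ⟨ContDiff.mul ?_ hf.1, fun h hh => ⟨?_, ?_⟩⟩
  · refine ContDiff.cexp (contDiff_const.mul ?_)
    exact Complex.ofRealCLM.contDiff.comp (contDiff_const.inner ℝ contDiff_id)
  · refine (hf.2 h hh).1.translate hh 0 fun y => ?_
    simp only [_root_.modulation, norm_mul, norm_exp_two_pi_I, one_mul, sub_zero]
  · exact (hf.2 h hh).2.translate hh ξ fun w => by rw [fourier_modulation]

theorem IsSigma1.conj {d : ℕ} {f : Rd d → ℂ} (hf : IsSigma1 f) :
    IsSigma1 (fun y => starRingEnd ℂ (f y)) := by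
  refine ⟨Complex.conjCLE.contDiff.comp hf.1, fun h hh => ⟨?_, ?_⟩⟩
  · exact (hf.2 h hh).1.translate hh 0 fun y => by rw [RCLike.norm_conj, sub_zero]
  · exact (hf.2 h hh).2.reflect fun w => norm_fourier_conj f w

/-- The test function `conj (M_ξ T_x φ) ∈ Σ_1(ℝ^d)`. -/
def Sigma1.conjShift {d : ℕ} (x ξ : Rd d) (φ : Sigma1 d) : Sigma1 d :=
  ⟨fun y => starRingEnd ℂ (modulation ξ (translation x φ.toFun) y),
    ((φ.isSigma1.translation x).modulation ξ).conj⟩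

/-- The short-time Fourier transform `V_φ u(x, ξ) = ⟨u, M_ξ T_x φ⟩` of `u ∈ Σ_1'(ℝ^d)`. The
bracket is conjugate linear in its second argument, while `u` acts linearly. -/
def stft {d : ℕ} (φ : Sigma1 d) (u : Sigma1Dual d) (x ξ : Rd d) : ℂ :=
  u (φ.conjShift x ξ)

/-! ### Coorbit spaces -/

/-- The coorbit space `Co Y^{h,s}(ℝ^d)` with window `φ`. -/
def coorbit {d : ℕ} (φ : Sigma1 d) (h s : ℝ) : Set (Sigma1Dual d) :=
  {u | ∫⁻ ξ : Rd d, (∫⁻ x : Rd d, ‖stft φ u x ξ‖ₑ ^ 2) *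
    ENNReal.ofReal (Real.exp (2 * h * ‖ξ‖ ^ (1 / s))) < ⊤}

/-- The space `F Co Y^{h,s}(ℝ^d)` with window `φ`: all `u` with `û ∈ Co Y^{h,s}(ℝ^d)`. -/
def fourierCoorbit {d : ℕ} (φ : Sigma1 d) (h s : ℝ) : Set (Sigma1Dual d) :=
  {u | u.fourier ∈ coorbit φ h s}

/-! ### Functions as elements of `Σ_1'` -/

/-- `u ∈ Σ_1'(ℝ^d)` is the function `f`: the pairing with each test function is
`∫ f(x) φ(x) dx`, as an absolutely convergent integral. -/
def Represents {d : ℕ} (f : Rd d → ℂ) (u : Sigma1Dual d) : Prop :=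
  LocallyIntegrable f ∧ ∀ φ : Sigma1 d,
    Integrable (fun x => f x * φ.toFun x) ∧ u φ = ∫ x, f x * φ.toFun x

end

open scoped BoundedContinuousFunction

/-!
Everything is compared with the `L¹` condition that `e^{h|x|^{1/s}} f` and `e^{h|ξ|^{1/s}} f̂` are
integrable, each comparison costing a factor in `h`.

The `L¹` condition follows from the pointwise bounds, and it gives `S_s` regularity by localization:
with the Gaussian `γ(y) = e^{-π|y|²}`, the Fourier transform of `f γ(· - x)` decays both in `x` and
in `ξ`, so the derivatives of `f γ(· - x)` satisfy Gevrey estimates that decay in `x`. Dividing by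
the Gaussian near `x`, which is harmless because it is analytic and `s > 1`, yields
`|∂^β f(x)| ≤ C B^n n!^s e^{-(h/2)|x|^{1/s}}` for `n = |β|`. Conversely, the estimates
`|x_k^n f(x)| ≤ C H^n n!^s`, optimised over `n`, give the decay of `f`, and likewise for `f̂`.

The `L¹` condition makes `V_φ f` decay in both variables, hence gives the coorbit conditions.
In the other direction, inverting the short-time Fourier transform turns the weighted `L²` bound on
`V_φ u` into an estimate of `u` against a weighted `L²` norm of the test function. By Riesz
representation `u` is then a function, in a weighted `L²` space and so, for a smaller `h`, in a
weighted `L¹` space. Since `|V_φ u(x, ξ)| = |V_{φ̂} û(ξ, -x)|`, this applies both to `û` and to its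
Fourier transform.
-/

noncomputable section

/-! ### Gevrey weights -/

section Weight

variable {E : Type*} [NormedAddCommGroup E] {s h k : ℝ}

/-- The Gevrey weight `e^{h ‖x‖^{1/s}}`. Negative `h` gives the reciprocal weights. -/
def gevreyWeight (s h : ℝ) (x : E) : ℝ := Real.exp (h * ‖x‖ ^ (1 / s))

theorem gevreyWeight_pos (s h : ℝ) (x : E) : 0 < gevreyWeight s h x := Real.exp_pos _

theorem norm_gevreyWeight (s h : ℝ) (x : E) : ‖gevreyWeight s h x‖ = gevreyWeight s h x :=
  Real.norm_of_nonneg (gevreyWeight_pos s h x).le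

theorem gevreyWeight_add (s h k : ℝ) (x : E) :
    gevreyWeight s (h + k) x = gevreyWeight s h x * gevreyWeight s k x := by
  simp only [gevreyWeight, add_mul, Real.exp_add]

theorem gevreyWeight_neg_rate (s h : ℝ) (x : E) :
    gevreyWeight s (-h) x = (gevreyWeight s h x)⁻¹ := by
  simp only [gevreyWeight, neg_mul, Real.exp_neg]

theorem gevreyWeight_sq (s h : ℝ) (x : E) :
    gevreyWeight s h x ^ 2 = gevreyWeight s (2 * h) x := by
  rw [sq, ← gevreyWeight_add, two_mul]

theorem gevreyWeight_neg (s h : ℝ) (x : E) : gevreyWeight s h (-x) = gevreyWeight s h x := by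
  simp only [gevreyWeight, norm_neg]

theorem continuous_gevreyWeight (hs : 0 ≤ s) (h : ℝ) :
    Continuous (gevreyWeight s h : E → ℝ) :=
  Real.continuous_exp.comp <| continuous_const.mul <|
    continuous_norm.rpow_const fun _ => Or.inr (by positivity)

theorem tendsto_gevreyWeight_cocompact [ProperSpace E] (hs : 0 < s) (hh : 0 < h) :
    Filter.Tendsto (fun x : E => gevreyWeight s (-h) x) (Filter.cocompact E) (nhds 0) :=
  Real.tendsto_exp_comp_nhds_zero.2 <| ((tendsto_rpow_atTop (one_div_pos.2 hs)).comp
    tendsto_norm_cocompact_atTop).const_mul_atTop_of_neg (neg_lt_zero.2 hh)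

theorem gevreyWeight_mono (hhk : h ≤ k) (x : E) : gevreyWeight s h x ≤ gevreyWeight s k x :=
  Real.exp_le_exp.2 (by gcongr)

theorem gevreyWeight_le_mul_sub (hs : 1 ≤ s) (hh : 0 ≤ h) (x y : E) :
    gevreyWeight s h x ≤ gevreyWeight s h y * gevreyWeight s h (y - x) := by
  have hs' : 1 / s ≤ 1 := div_le_one_of_le₀ hs (by positivity)
  rw [gevreyWeight, gevreyWeight, gevreyWeight, ← Real.exp_add, ← mul_add]
  gcongr
  calc ‖x‖ ^ (1 / s) ≤ (‖y‖ + ‖y - x‖) ^ (1 / s) := by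
        gcongr
        simpa using norm_sub_le y (y - x)
    _ ≤ ‖y‖ ^ (1 / s) + ‖y - x‖ ^ (1 / s) :=
        Real.rpow_add_le_add_rpow (norm_nonneg _) (norm_nonneg _) (by positivity) hs'

theorem gevreyWeight_le_exp (hs : 1 ≤ s) (hh : 0 ≤ h) (x : E) :
    gevreyWeight s h x ≤ Real.exp h * Real.exp (h * ‖x‖) := by
  have hs' : 1 / s ≤ 1 := div_le_one_of_le₀ hs (by positivity)
  rw [gevreyWeight, ← Real.exp_add]
  have hle : ‖x‖ ^ (1 / s) ≤ 1 + ‖x‖ :=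
    calc ‖x‖ ^ (1 / s) ≤ (1 + ‖x‖) ^ (1 / s) := by gcongr; linarith
      _ ≤ (1 + ‖x‖) ^ (1 : ℝ) :=
          Real.rpow_le_rpow_of_exponent_le (by linarith [norm_nonneg x]) hs'
      _ = 1 + ‖x‖ := Real.rpow_one _
  gcongr
  nlinarith

/-- The power series of `exp` bounds `(k t^{1/s})^m / m!`; raise this to the power `s`. -/
theorem pow_le_factorial_rpow_mul_exp {t : ℝ} (hs : 0 < s) (ht : 0 ≤ t) (hk : 0 < k) (m : ℕ) :
    t ^ m ≤ (k ^ (-s)) ^ m * (m.factorial : ℝ) ^ s * Real.exp (s * k * t ^ (1 / s)) := by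
  set r := t ^ (1 / s)
  have hr : 0 ≤ r := by positivity
  have hrt : r ^ s = t := by
    simp only [r, one_div]
    exact Real.rpow_inv_rpow ht hs.ne'
  have hexp : (k * r) ^ m ≤ Real.exp (k * r) * m.factorial := by
    simpa [div_le_iff₀, Nat.factorial_pos] using
      Real.pow_div_factorial_le_exp (k * r) (by positivity) m
  have hpow : ((k * r) ^ m) ^ s = (k ^ s) ^ m * t ^ m := by
    rw [← Real.rpow_pow_comm (by positivity), Real.mul_rpow hk.le hr, hrt, mul_pow]
  calc t ^ m = (k ^ (-s)) ^ m * ((k * r) ^ m) ^ s := by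
        rw [hpow, ← mul_assoc, ← mul_pow, ← Real.rpow_add hk, neg_add_cancel, Real.rpow_zero,
          one_pow, one_mul]
    _ ≤ (k ^ (-s)) ^ m * (Real.exp (k * r) * m.factorial) ^ s := by gcongr
    _ = (k ^ (-s)) ^ m * (m.factorial : ℝ) ^ s * Real.exp (s * k * r) := by
        rw [Real.mul_rpow (by positivity) (by positivity), ← Real.exp_mul]
        ring_nf

theorem exists_one_add_norm_pow_mul_gevreyWeight_le (hs : 1 ≤ s) (hh : 0 < h) (m : ℕ) :
    ∃ C : ℝ, ∀ x : E, (1 + ‖x‖) ^ m * gevreyWeight s (-h) x ≤ C := by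
  have hs0 : 0 < s := by linarith
  refine ⟨((h / s) ^ (-s)) ^ m * (m.factorial : ℝ) ^ s * Real.exp h, fun x => ?_⟩
  have hpow := pow_le_factorial_rpow_mul_exp hs0 (by positivity : 0 ≤ 1 + ‖x‖)
    (div_pos hh hs0) m
  have hsub : (1 + ‖x‖) ^ (1 / s) ≤ 1 + ‖x‖ ^ (1 / s) := by
    simpa using Real.rpow_add_le_add_rpow (p := 1 / s) zero_le_one (norm_nonneg x)
      (by positivity) (div_le_one_of_le₀ hs hs0.le)
  have hexp : Real.exp (h * (1 + ‖x‖) ^ (1 / s)) ≤ Real.exp h * gevreyWeight s h x := by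
    rw [gevreyWeight, ← Real.exp_add]
    gcongr
    nlinarith
  rw [mul_div_cancel₀ h hs0.ne'] at hpow
  rw [gevreyWeight_neg_rate, ← div_eq_mul_inv, div_le_iff₀ (gevreyWeight_pos s h x), mul_assoc]
  exact hpow.trans (by gcongr)

section Integrable

variable [NormedSpace ℝ E] [FiniteDimensional ℝ E] [MeasurableSpace E] [BorelSpace E]
  {μ : Measure E} [μ.IsAddHaarMeasure]

theorem integrable_pow_mul_gevreyWeight (hs : 1 ≤ s) (hh : 0 < h) (n : ℕ) :
    Integrable (fun x : E => ‖x‖ ^ n * gevreyWeight s (-h) x) μ := by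
  obtain ⟨C, hC⟩ := exists_one_add_norm_pow_mul_gevreyWeight_le (E := E) hs hh
    (n + (Module.finrank ℝ E + 1))
  have hcont := continuous_gevreyWeight (E := E) (by linarith : 0 ≤ s) (-h)
  have hint : Integrable (fun x : E => (1 + ‖x‖) ^ (-((Module.finrank ℝ E + 1 : ℕ) : ℝ))) μ :=
    integrable_one_add_norm (by exact_mod_cast Nat.lt_succ_self _)
  refine (hint.const_mul C).mono' (by fun_prop) (.of_forall fun x => ?_)
  have hw := gevreyWeight_pos s (-h) x
  rw [Real.norm_of_nonneg (by positivity), Real.rpow_neg (by positivity), Real.rpow_natCast,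
    ← div_eq_mul_inv, le_div_iff₀ (by positivity)]
  calc ‖x‖ ^ n * gevreyWeight s (-h) x * (1 + ‖x‖) ^ (Module.finrank ℝ E + 1)
      ≤ (1 + ‖x‖) ^ n * gevreyWeight s (-h) x * (1 + ‖x‖) ^ (Module.finrank ℝ E + 1) := by
        gcongr
        linarith
    _ = (1 + ‖x‖) ^ (n + (Module.finrank ℝ E + 1)) * gevreyWeight s (-h) x := by ring
    _ ≤ C := hC x

theorem integrable_gevreyWeight (hs : 1 ≤ s) (hh : 0 < h) :
    Integrable (fun x : E => gevreyWeight s (-h) x) μ := by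
  simpa using integrable_pow_mul_gevreyWeight (μ := μ) hs hh 0

theorem memLp_two_gevreyWeight (hs : 1 ≤ s) (hh : 0 < h) :
    MemLp (fun x : E => gevreyWeight s (-h) x) 2 μ := by
  rw [memLp_two_iff_integrable_sq
    (continuous_gevreyWeight (by linarith) _).aestronglyMeasurable]
  simpa only [gevreyWeight_sq, mul_neg] using
    integrable_gevreyWeight (μ := μ) hs (by positivity : 0 < 2 * h)

end Integrable

end Weight

/-! ### Fourier analysis of integrable functions -/

section Fourier

variable {V : Type*} [NormedAddCommGroup V] [InnerProductSpace ℝ V] [FiniteDimensional ℝ V]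
  [MeasurableSpace V] [BorelSpace V]
  {F : Type*} [NormedAddCommGroup F] [NormedSpace ℂ F]

theorem continuous_fourier_of_integrable {f : V → F} (hf : Integrable f) : Continuous (𝓕 f) :=
  VectorFourier.fourierIntegral_continuous (L := innerₗ V) Real.continuous_fourierChar
    continuous_inner hf

theorem continuous_fourierInv_of_integrable {f : V → F} (hf : Integrable f) :
    Continuous (𝓕⁻ f) := by
  rw [Real.fourierInv_eq_fourier_comp_neg]
  exact continuous_fourier_of_integrable hf.comp_neg

theorem norm_fourier_le_integral (f : V → F) (ξ : V) : ‖𝓕 f ξ‖ ≤ ∫ x, ‖f x‖ :=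
  VectorFourier.norm_fourierIntegral_le_integral_norm _ _ _ f ξ

theorem integral_fourier_smul [CompleteSpace F] {f : V → ℂ} {g : V → F} (hf : Integrable f)
    (hg : Integrable g) : ∫ ξ, 𝓕 f ξ • g ξ = ∫ x, f x • 𝓕 g x := by
  have := VectorFourier.integral_fourierIntegral_smul_eq_flip (L := innerₗ V)
    Real.continuous_fourierChar continuous_inner hf hg
  rwa [flip_innerₗ] at this

theorem integral_fourierInv_smul [CompleteSpace F] {f : V → ℂ} {g : V → F} (hf : Integrable f)
    (hg : Integrable g) : ∫ ξ, 𝓕⁻ f ξ • g ξ = ∫ x, f x • 𝓕⁻ g x := by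
  rw [Real.fourierInv_eq_fourier_comp_neg f, integral_fourier_smul hf.comp_neg hg,
    ← integral_neg_eq_self]
  simp only [neg_neg, Real.fourierInv_eq_fourier_neg]

/-- Fourier inversion, tested against Schwartz functions. -/
theorem fourierInv_fourier_ae_eq [CompleteSpace F] {f : V → F} (hf : Integrable f)
    (hf' : Integrable (𝓕 f)) : 𝓕⁻ (𝓕 f) =ᵐ[volume] f := by
  refine ae_eq_of_integral_contDiff_smul_eq
    (continuous_fourierInv_of_integrable hf').locallyIntegrable hf.locallyIntegrable
    fun g hg hgs => ?_
  let G : SchwartzMap V ℂ := (hgs.comp_left (g := ((↑) : ℝ → ℂ)) rfl).toSchwartzMap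
    (Complex.ofRealCLM.contDiff.comp hg)
  have hG : 𝓕 (𝓕⁻ (G : V → ℂ)) = G := by
    rw [← SchwartzMap.fourierInv_coe, ← SchwartzMap.fourier_coe,
      FourierTransform.fourier_fourierInv_eq]
  have hG' : Integrable (𝓕⁻ (G : V → ℂ)) := by
    rw [← SchwartzMap.fourierInv_coe]
    exact SchwartzMap.integrable _
  calc ∫ x, g x • 𝓕⁻ (𝓕 f) x = ∫ x, G x • 𝓕⁻ (𝓕 f) x := rfl
    _ = ∫ x, 𝓕 (𝓕⁻ (G : V → ℂ)) x • f x := by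
        rw [← integral_fourierInv_smul G.integrable hf', ← integral_fourier_smul hG' hf]
    _ = ∫ x, g x • f x := by rw [hG]; rfl

theorem ae_eq_zero_of_fourier_eq_zero [CompleteSpace F] {f : V → F} (hf : Integrable f)
    (h : 𝓕 f = 0) : f =ᵐ[volume] 0 := by
  refine (fourierInv_fourier_ae_eq hf (h ▸ integrable_zero _ _ _)).symm.trans (.of_forall ?_)
  simp [h, Real.fourierInv_eq]

theorem fourierInv_exp_mul (g : V → ℂ) (ξ η : V) :
    𝓕⁻ (fun y => Complex.exp ((-2 * π * ⟪y, ξ⟫_ℝ : ℝ) * Complex.I) * g y) η = 𝓕 g (ξ - η) := by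
  rw [Real.fourierInv_eq', Real.fourier_eq']
  congr 1 with y
  rw [smul_eq_mul, smul_eq_mul, ← mul_assoc, ← Complex.exp_add, inner_sub_right]
  congr 2
  push_cast
  ring

theorem fourier_mul_eq_integral {f g : V → ℂ} (hf : Integrable f) (hf' : Integrable (𝓕 f))
    (hg : Integrable g) (ξ : V) : 𝓕 (fun y => f y * g y) ξ = ∫ η, 𝓕 f η * 𝓕 g (ξ - η) := by
  set e : V → ℂ := fun y => Complex.exp ((-2 * π * ⟪y, ξ⟫_ℝ : ℝ) * Complex.I)
  have heg : Integrable fun y => e y * g y :=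
    hg.bdd_mul (c := 1) (Continuous.aestronglyMeasurable (by fun_prop))
      (.of_forall fun y => (Complex.norm_exp_ofReal_mul_I _).le)
  calc 𝓕 (fun y => f y * g y) ξ = ∫ y, f y • (e y * g y) := by
        rw [Real.fourier_eq']
        congr 1 with y
        simp only [smul_eq_mul, e]
        ring
    _ = ∫ y, 𝓕⁻ (𝓕 f) y • (e y * g y) := by
        refine integral_congr_ae ?_
        filter_upwards [fourierInv_fourier_ae_eq hf hf'] with y hy
        rw [hy]
    _ = ∫ η, 𝓕 f η * 𝓕 g (ξ - η) := by
        rw [integral_fourierInv_smul hf' heg]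
        simp only [smul_eq_mul, e, fourierInv_exp_mul]

theorem conj_fourierInv (f : V → ℂ) (η : V) :
    starRingEnd ℂ (𝓕⁻ f η) = 𝓕 (fun y => starRingEnd ℂ (f y)) η := by
  rw [Real.fourierInv_eq', Real.fourier_eq', ← integral_conj]
  refine integral_congr_ae (Filter.Eventually.of_forall fun y => ?_)
  simp only [smul_eq_mul, map_mul, ← Complex.exp_conj, Complex.conj_I, Complex.conj_ofReal]
  congr 2
  push_cast
  ring

theorem integral_mul_conj_self {X : Type*} [MeasurableSpace X] {μ : Measure X} (f : X → ℂ) :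
    ∫ x, f x * starRingEnd ℂ (f x) ∂μ = ((∫ x, ‖f x‖ ^ 2 ∂μ : ℝ) : ℂ) := by
  simp only [← integral_complex_ofReal, Complex.mul_conj', Complex.ofReal_pow]

theorem lintegral_enorm_sq_eq_ofReal_re {X : Type*} [MeasurableSpace X] {μ : Measure X}
    {f : X → ℂ} {C : ℝ} (hf : Integrable f μ) (hC : ∀ᵐ x ∂μ, ‖f x‖ ≤ C) :
    ∫⁻ x, ‖f x‖ₑ ^ 2 ∂μ = ENNReal.ofReal (∫ x, f x * starRingEnd ℂ (f x) ∂μ).re := by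
  have hsq : Integrable (fun x => ‖f x‖ ^ 2) μ := by
    simp only [sq]
    exact hf.norm.mul_bdd hf.aestronglyMeasurable.norm (by simpa using hC)
  rw [integral_mul_conj_self, Complex.ofReal_re, ofReal_integral_eq_lintegral_ofReal hsq
    (.of_forall fun x => by positivity)]
  simp only [ENNReal.ofReal_pow (norm_nonneg _), ofReal_norm]

theorem lintegral_enorm_sq_fourier {f : V → ℂ} (hf : Integrable f) (hf' : Integrable (𝓕 f)) :
    ∫⁻ ξ, ‖𝓕 f ξ‖ₑ ^ 2 = ∫⁻ x, ‖f x‖ₑ ^ 2 := by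
  have hinv := fourierInv_fourier_ae_eq hf hf'
  have hbound : ∀ᵐ x, ‖f x‖ ≤ ∫ ξ, ‖𝓕 f ξ‖ := by
    filter_upwards [hinv] with x hx
    rw [← hx, Real.fourierInv_eq_fourier_neg]
    exact norm_fourier_le_integral _ _
  rw [lintegral_enorm_sq_eq_ofReal_re hf' (.of_forall (norm_fourier_le_integral f)),
    lintegral_enorm_sq_eq_ofReal_re hf hbound]
  congr 2
  calc ∫ ξ, 𝓕 f ξ * starRingEnd ℂ (𝓕 f ξ)
      = ∫ x, f x * 𝓕 (fun ξ => starRingEnd ℂ (𝓕 f ξ)) x :=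
        integral_fourier_smul hf ((Complex.conjCLE : ℂ →L[ℝ] ℂ).integrable_comp hf')
    _ = ∫ x, f x * starRingEnd ℂ (f x) := by
        refine integral_congr_ae ?_
        filter_upwards [hinv] with x hx
        rw [← conj_fourierInv, hx]

theorem fourier_integral {P F : Type*} [NormedAddCommGroup F] [NormedSpace ℂ F]
    [MeasurableSpace P] {ν : Measure P} [SFinite ν] {f : P → V → F}
    (hf : Integrable (Function.uncurry f) (ν.prod volume)) (η : V) :
    𝓕 (fun y => ∫ p, f p y ∂ν) η = ∫ p, 𝓕 (f p) η ∂ν := by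
  have hchar : Continuous fun y : V => (Real.fourierChar (-⟪y, η⟫_ℝ) : ℂ) := by fun_prop
  have hswap : Integrable (Function.uncurry fun y p => (Real.fourierChar (-⟪y, η⟫_ℝ) : ℂ) • f p y)
      (volume.prod ν) :=
    hf.swap.bdd_smul 1 hchar.aestronglyMeasurable.comp_fst
      (.of_forall fun q => (Circle.norm_coe _).le)
  simp only [Real.fourier_eq, Circle.smul_def, ← integral_smul]
  exact integral_integral_swap hswap

end Fourier

/-! ### Weighted integrability of a function and of its Fourier transform -/

theorem pow_mul_norm_le_gevreyWeight_smul {E F : Type*} [NormedAddCommGroup E]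
    [NormedAddCommGroup F] [NormedSpace ℝ F] {s h : ℝ} (hs : 0 < s) (hh : 0 < h) (f : E → F)
    (n : ℕ) (x : E) :
    ‖x‖ ^ n * ‖f x‖ ≤ ((h / s) ^ (-s)) ^ n * (n.factorial : ℝ) ^ s *
      ‖gevreyWeight s h x • f x‖ := by
  have hpow := pow_le_factorial_rpow_mul_exp hs (norm_nonneg x) (div_pos hh hs) n
  rw [mul_div_cancel₀ h hs.ne'] at hpow
  rw [norm_smul, norm_gevreyWeight, ← mul_assoc]
  exact mul_le_mul_of_nonneg_right hpow (norm_nonneg _)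

theorem norm_gevreyWeight_smul_le {E F : Type*} [NormedAddCommGroup E]
    [NormedAddCommGroup F] [NormedSpace ℝ F] {s h C : ℝ} (k : ℝ) {f : E → F} {x : E}
    (hC : ‖f x‖ * gevreyWeight s h x ≤ C) :
    ‖gevreyWeight s k x • f x‖ ≤ C * gevreyWeight s (-(h - k)) x :=
  calc ‖gevreyWeight s k x • f x‖ = ‖f x‖ * gevreyWeight s h x * gevreyWeight s (-(h - k)) x := by
        rw [norm_smul, norm_gevreyWeight, mul_assoc, ← gevreyWeight_add, mul_comm]
        ring_nf
    _ ≤ C * gevreyWeight s (-(h - k)) x :=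
        mul_le_mul_of_nonneg_right hC (gevreyWeight_pos _ _ _).le

section WeightedIntegrable

variable {E : Type*} [NormedAddCommGroup E] [MeasurableSpace E] [BorelSpace E] {μ : Measure E}
  {F : Type*} [NormedAddCommGroup F] [NormedSpace ℝ F] {s h k : ℝ} {f : E → F}

theorem integrable_gevreyWeight_smul_of_le (hs : 0 ≤ s) (hkh : k ≤ h)
    (hf : Integrable (fun x => gevreyWeight s h x • f x) μ) :
    Integrable (fun x => gevreyWeight s k x • f x) μ := by
  have hle : ∀ x : E, ‖gevreyWeight s (k - h) x‖ ≤ 1 := fun x => by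
    rw [norm_gevreyWeight]
    calc gevreyWeight s (k - h) x ≤ gevreyWeight s 0 x := gevreyWeight_mono (by linarith) x
      _ = 1 := by simp [gevreyWeight]
  have := hf.bdd_smul 1 (continuous_gevreyWeight hs (k - h)).aestronglyMeasurable (.of_forall hle)
  simpa only [Pi.smul_def', smul_smul, ← gevreyWeight_add, sub_add_cancel] using this

theorem integrable_of_gevreyWeight_smul (hs : 0 ≤ s) (hh : 0 ≤ h)
    (hf : Integrable (fun x => gevreyWeight s h x • f x) μ) : Integrable f μ := by
  simpa [gevreyWeight] using integrable_gevreyWeight_smul_of_le hs hh hf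

theorem integrable_pow_mul_norm_of_gevreyWeight_smul (hs : 0 < s) (hh : 0 < h)
    (hf : Integrable (fun x => gevreyWeight s h x • f x) μ) (n : ℕ) :
    Integrable (fun x => ‖x‖ ^ n * ‖f x‖) μ := by
  have hf' := integrable_of_gevreyWeight_smul hs.le hh.le hf
  refine (hf.norm.const_mul (((h / s) ^ (-s)) ^ n * (n.factorial : ℝ) ^ s)).mono'
    ((continuous_norm.pow n).aestronglyMeasurable.mul hf'.1.norm) (.of_forall fun x => ?_)
  rw [Real.norm_of_nonneg (by positivity)]
  exact pow_mul_norm_le_gevreyWeight_smul hs hh f n x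

theorem integrable_gevreyWeight_smul_of_norm_le [NormedSpace ℝ E] [FiniteDimensional ℝ E]
    [μ.IsAddHaarMeasure] {C : ℝ} (hs : 1 ≤ s) (hkh : k < h) (hf : AEStronglyMeasurable f μ)
    (hC : ∀ x, ‖f x‖ * gevreyWeight s h x ≤ C) :
    Integrable (fun x => gevreyWeight s k x • f x) μ :=
  ((integrable_gevreyWeight (μ := μ) hs (sub_pos.2 hkh)).const_mul C).mono'
    ((continuous_gevreyWeight (by linarith) k).aestronglyMeasurable.smul hf)
    (.of_forall fun x => norm_gevreyWeight_smul_le k (hC x))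

end WeightedIntegrable

section FourierRegularity

variable {V : Type*} [NormedAddCommGroup V] [InnerProductSpace ℝ V] [FiniteDimensional ℝ V]
  [MeasurableSpace V] [BorelSpace V] {F : Type*} [NormedAddCommGroup F] [NormedSpace ℂ F]
  {s h : ℝ} {g : V → F}

theorem norm_iteratedFDeriv_fourier_le_integral
    (hg : AEStronglyMeasurable g) (hg' : ∀ n : ℕ, Integrable fun v => ‖v‖ ^ n * ‖g v‖) (n : ℕ)
    (x : V) : ‖iteratedFDeriv ℝ n (𝓕 g) x‖ ≤ (2 * π) ^ n * ∫ v, ‖v‖ ^ n * ‖g v‖ := by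
  rw [Real.iteratedFDeriv_fourier (N := ⊤) (fun n _ => hg' n) hg le_top]
  refine (VectorFourier.norm_fourierIntegral_le_integral_norm _ _ _ _ _).trans ?_
  rw [← integral_const_mul]
  refine integral_mono_of_nonneg (.of_forall fun _ => norm_nonneg _) ((hg' n).const_mul _)
    (.of_forall fun v => ?_)
  calc ‖VectorFourier.fourierPowSMulRight (innerSL ℝ) g v n‖
      ≤ (2 * π * ‖innerSL ℝ (E := V)‖) ^ n * ‖v‖ ^ n * ‖g v‖ :=
        VectorFourier.norm_fourierPowSMulRight_le _ _ _ _
    _ ≤ (2 * π) ^ n * (‖v‖ ^ n * ‖g v‖) := by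
        rw [mul_assoc]
        gcongr ?_ ^ n * _
        exact mul_le_of_le_one_right (by positivity) (norm_innerSL_le ℝ)

theorem contDiff_fourier_of_gevreyWeight_smul (hs : 0 < s) (hh : 0 < h)
    (hg : Integrable fun ξ => gevreyWeight s h ξ • g ξ) : ContDiff ℝ ∞ (𝓕 g) :=
  Real.contDiff_fourier fun n _ => integrable_pow_mul_norm_of_gevreyWeight_smul hs hh hg n

theorem norm_iteratedFDeriv_fourier_le_of_gevreyWeight_smul (hs : 0 < s) (hh : 0 < h)
    (hg : Integrable fun ξ => gevreyWeight s h ξ • g ξ) (n : ℕ) (x : V) :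
    ‖iteratedFDeriv ℝ n (𝓕 g) x‖ ≤
      (2 * π * (h / s) ^ (-s)) ^ n * (n.factorial : ℝ) ^ s * ∫ ξ, ‖gevreyWeight s h ξ • g ξ‖ := by
  have hpow := integrable_pow_mul_norm_of_gevreyWeight_smul hs hh hg
  calc ‖iteratedFDeriv ℝ n (𝓕 g) x‖ ≤ (2 * π) ^ n * ∫ v, ‖v‖ ^ n * ‖g v‖ :=
        norm_iteratedFDeriv_fourier_le_integral
          (integrable_of_gevreyWeight_smul hs.le hh.le hg).1 hpow n x
    _ ≤ (2 * π) ^ n * ∫ v, ((h / s) ^ (-s)) ^ n * (n.factorial : ℝ) ^ s *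
          ‖gevreyWeight s h v • g v‖ := by
        gcongr ?_ * ?_
        exact integral_mono (hpow n) (hg.norm.const_mul _)
          (pow_mul_norm_le_gevreyWeight_smul hs hh g n)
    _ = _ := by
        rw [integral_const_mul, mul_pow]
        ring

theorem integrable_gevreyWeight_smul_comp_neg (hg : Integrable fun ξ => gevreyWeight s h ξ • g ξ) :
    Integrable fun ξ => gevreyWeight s h ξ • g (-ξ) := by
  simpa only [gevreyWeight_neg] using hg.comp_neg

theorem contDiff_fourierInv_of_gevreyWeight_smul (hs : 0 < s) (hh : 0 < h)
    (hg : Integrable fun ξ => gevreyWeight s h ξ • g ξ) : ContDiff ℝ ∞ (𝓕⁻ g) := by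
  rw [Real.fourierInv_eq_fourier_comp_neg]
  exact contDiff_fourier_of_gevreyWeight_smul hs hh (integrable_gevreyWeight_smul_comp_neg hg)

theorem norm_iteratedFDeriv_fourierInv_le_of_gevreyWeight_smul (hs : 0 < s) (hh : 0 < h)
    (hg : Integrable fun ξ => gevreyWeight s h ξ • g ξ) (n : ℕ) (x : V) :
    ‖iteratedFDeriv ℝ n (𝓕⁻ g) x‖ ≤
      (2 * π * (h / s) ^ (-s)) ^ n * (n.factorial : ℝ) ^ s * ∫ ξ, ‖gevreyWeight s h ξ • g ξ‖ := by
  rw [Real.fourierInv_eq_fourier_comp_neg,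
    ← integral_neg_eq_self fun ξ => ‖gevreyWeight s h ξ • g ξ‖]
  simpa only [gevreyWeight_neg] using norm_iteratedFDeriv_fourier_le_of_gevreyWeight_smul hs hh
    (integrable_gevreyWeight_smul_comp_neg hg) n x

end FourierRegularity

section GevreyIntegrable

variable {V : Type*} [NormedAddCommGroup V] [InnerProductSpace ℝ V] [FiniteDimensional ℝ V]
  [MeasurableSpace V] [BorelSpace V] {s h k : ℝ} {f g : V → ℂ}

/-- Both `f` and its Fourier transform are integrable against the weight `e^{h ‖x‖^{1/s}}`. In
contrast to pointwise bounds, this does not depend on the representative of `f`. -/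
structure GevreyIntegrable (s h : ℝ) (f : V → ℂ) : Prop where
  weight_smul : Integrable fun x => gevreyWeight s h x • f x
  weight_smul_fourier : Integrable fun ξ => gevreyWeight s h ξ • 𝓕 f ξ

namespace GevreyIntegrable

theorem integrable (hs : 0 ≤ s) (hh : 0 ≤ h) (hf : GevreyIntegrable s h f) : Integrable f :=
  integrable_of_gevreyWeight_smul hs hh hf.weight_smul

theorem integrable_fourier (hs : 0 ≤ s) (hh : 0 ≤ h) (hf : GevreyIntegrable s h f) :
    Integrable (𝓕 f) :=
  integrable_of_gevreyWeight_smul hs hh hf.weight_smul_fourier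

theorem congr_ae (hf : GevreyIntegrable s h f) (hfg : f =ᵐ[volume] g) :
    GevreyIntegrable s h g where
  weight_smul := hf.weight_smul.congr (hfg.mono fun x hx => by simp only [hx])
  weight_smul_fourier := by
    simpa only [Real.fourier_congr_ae hfg] using hf.weight_smul_fourier

theorem fourier (hs : 0 ≤ s) (hh : 0 ≤ h) (hf : GevreyIntegrable s h f) :
    GevreyIntegrable s h (𝓕 f) where
  weight_smul := hf.weight_smul_fourier
  weight_smul_fourier := by
    have hinv := fourierInv_fourier_ae_eq (hf.integrable hs hh) (hf.integrable_fourier hs hh)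
    simpa only [Real.fourierInv_eq_fourier_neg, gevreyWeight_neg, neg_neg] using
      (hf.congr_ae hinv.symm).weight_smul.comp_neg

theorem fourierInv (hs : 0 ≤ s) (hh : 0 ≤ h) (hf : GevreyIntegrable s h f) :
    GevreyIntegrable s h (𝓕⁻ f) where
  weight_smul := by
    simpa only [Real.fourierInv_eq_fourier_neg, gevreyWeight_neg] using
      hf.weight_smul_fourier.comp_neg
  weight_smul_fourier := by
    have hinv := fourierInv_fourier_ae_eq (hf.integrable hs hh) (hf.integrable_fourier hs hh)
    rw [Real.fourierInv_comm]
    exact (hf.congr_ae hinv.symm).weight_smul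

end GevreyIntegrable

theorem integral_norm_mul_translate_le (hs : 1 ≤ s) (hh : 0 ≤ h) {A : ℝ}
    (hf : Integrable fun y => gevreyWeight s h y • f y)
    (hg : ∀ y, ‖g y‖ * gevreyWeight s h y ≤ A) (x : V) :
    ∫ y, ‖f y‖ * ‖g (y - x)‖ ≤
      A * (∫ y, ‖gevreyWeight s h y • f y‖) * gevreyWeight s (-h) x := by
  rw [gevreyWeight_neg_rate, ← div_eq_mul_inv, le_div_iff₀ (gevreyWeight_pos s h x),
    ← integral_mul_const, ← integral_const_mul]
  refine integral_mono_of_nonneg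
    (.of_forall fun y => by have := gevreyWeight_pos s h x; positivity)
    (hf.norm.const_mul A) (.of_forall fun y => ?_)
  calc ‖f y‖ * ‖g (y - x)‖ * gevreyWeight s h x
      ≤ ‖f y‖ * ‖g (y - x)‖ * (gevreyWeight s h y * gevreyWeight s h (y - x)) := by
        gcongr
        exact gevreyWeight_le_mul_sub hs hh x y
    _ = ‖g (y - x)‖ * gevreyWeight s h (y - x) * ‖gevreyWeight s h y • f y‖ := by
        rw [norm_smul, norm_gevreyWeight]
        ring
    _ ≤ A * ‖gevreyWeight s h y • f y‖ := by
        gcongr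
        exact hg _

theorem norm_fourier_comp_sub_right (g : V → ℂ) (x ξ : V) :
    ‖𝓕 (fun y => g (y - x)) ξ‖ = ‖𝓕 g ξ‖ := by
  have := congrFun (VectorFourier.fourierIntegral_comp_add_right Real.fourierChar volume
    (innerₗ V) g (-x)) ξ
  simp only [Function.comp_def, ← sub_eq_add_neg] at this
  rw [Real.fourier_eq, Real.fourier_eq]
  simpa [VectorFourier.fourierIntegral, Circle.norm_smul] using congrArg norm this

/-- The first bound is the trivial one, the second one comes from
`𝓕 (f · g(· - x)) = 𝓕 f * 𝓕 (g(· - x))`; the result is their geometric mean. -/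
theorem GevreyIntegrable.exists_norm_fourier_mul_translate_le (hs : 1 ≤ s) (hh : 0 ≤ h)
    (hf : GevreyIntegrable s h f) (hg : Integrable g) {A B : ℝ}
    (hgA : ∀ y, ‖g y‖ * gevreyWeight s h y ≤ A)
    (hgB : ∀ η, ‖𝓕 g η‖ * gevreyWeight s h η ≤ B) :
    ∃ C : ℝ, ∀ x ξ, ‖𝓕 (fun y => f y * g (y - x)) ξ‖ ≤
      C * (gevreyWeight s (-(h / 2)) x * gevreyWeight s (-(h / 2)) ξ) := by
  have hs0 : 0 ≤ s := by linarith
  set a := A * ∫ y, ‖gevreyWeight s h y • f y‖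
  set b := B * ∫ η, ‖gevreyWeight s h η • 𝓕 f η‖
  refine ⟨max a b, fun x ξ => ?_⟩
  have hx : ‖𝓕 (fun y => f y * g (y - x)) ξ‖ ≤ a * gevreyWeight s (-h) x := by
    refine (norm_fourier_le_integral _ _).trans ?_
    simpa only [norm_mul] using integral_norm_mul_translate_le hs hh hf.weight_smul hgA x
  have hξ : ‖𝓕 (fun y => f y * g (y - x)) ξ‖ ≤ b * gevreyWeight s (-h) ξ := by
    rw [fourier_mul_eq_integral (hf.integrable hs0 hh) (hf.integrable_fourier hs0 hh)
      (hg.comp_sub_right x)]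
    refine (norm_integral_le_integral_norm _).trans ?_
    simp only [norm_mul, norm_fourier_comp_sub_right]
    have hgB' : ∀ η, ‖𝓕 g (-η)‖ * gevreyWeight s h η ≤ B := fun η => by
      simpa only [gevreyWeight_neg] using hgB (-η)
    simpa only [neg_sub] using
      integral_norm_mul_translate_le hs hh hf.weight_smul_fourier hgB' ξ
  have hpos := gevreyWeight_pos s (-(h / 2)) x
  have hpos' := gevreyWeight_pos s (-(h / 2)) ξ
  have hsq : ∀ z : V, gevreyWeight s (-h) z = gevreyWeight s (-(h / 2)) z ^ 2 := fun z => by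
    rw [gevreyWeight_sq]
    ring_nf
  rw [hsq] at hx hξ
  have hC : 0 ≤ max a b := le_max_of_le_left
    (nonneg_of_mul_nonneg_left ((norm_nonneg _).trans hx) (by positivity))
  refine le_of_sq_le_sq ?_ (by positivity)
  calc ‖𝓕 (fun y => f y * g (y - x)) ξ‖ ^ 2
      ≤ (max a b * gevreyWeight s (-(h / 2)) x ^ 2) *
          (max a b * gevreyWeight s (-(h / 2)) ξ ^ 2) := by
        rw [sq]
        gcongr
        · exact hx.trans (by gcongr; exact le_max_left _ _)
        · exact hξ.trans (by gcongr; exact le_max_right _ _)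
    _ = _ := by ring

end GevreyIntegrable

/-! ### Gevrey estimates by localization with Gaussians -/

theorem exists_factorial_mul_pow_le {s A B : ℝ} (hs : 1 < s) (hA : 0 ≤ A) (hB : 0 < B) :
    ∃ C : ℝ, ∀ n : ℕ, (n.factorial : ℝ) * A ^ n ≤ C * B ^ n * (n.factorial : ℝ) ^ s := by
  refine ⟨Real.exp ((s - 1) * 1 * (A / B) ^ (1 / (s - 1))), fun n => ?_⟩
  have hpow := pow_le_factorial_rpow_mul_exp (sub_pos.2 hs) (div_nonneg hA hB.le) one_pos n
  rw [Real.one_rpow, one_pow, one_mul, div_pow, div_le_iff₀ (by positivity)] at hpow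
  calc (n.factorial : ℝ) * A ^ n ≤ n.factorial * ((n.factorial : ℝ) ^ (s - 1) *
        Real.exp ((s - 1) * 1 * (A / B) ^ (1 / (s - 1))) * B ^ n) := by gcongr
    _ = Real.exp ((s - 1) * 1 * (A / B) ^ (1 / (s - 1))) * B ^ n *
          ((n.factorial : ℝ) * (n.factorial : ℝ) ^ (s - 1)) := by ring
    _ = _ := by
        rw [mul_comm (n.factorial : ℝ), ← Real.rpow_add_one (by positivity), sub_add_cancel]

theorem norm_iteratedFDeriv_smul_le_of_factorial {E F : Type*} [NormedAddCommGroup E]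
    [NormedSpace ℝ E] [NormedAddCommGroup F] [NormedSpace ℝ F] {f : E → ℝ} {g : E → F} {x : E}
    {s B C D : ℝ} (hs : 0 ≤ s) (hB : 0 ≤ B) (hC : 0 ≤ C) (hD : 0 ≤ D)
    (hf : ContDiff ℝ ∞ f) (hg : ContDiff ℝ ∞ g)
    (hfx : ∀ n, ‖iteratedFDeriv ℝ n f x‖ ≤ C * B ^ n * (n.factorial : ℝ) ^ s)
    (hgx : ∀ n, ‖iteratedFDeriv ℝ n g x‖ ≤ D * B ^ n * (n.factorial : ℝ) ^ s) (n : ℕ) :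
    ‖iteratedFDeriv ℝ n (fun y => f y • g y) x‖ ≤
      C * D * (2 * B) ^ n * (n.factorial : ℝ) ^ s := by
  have hterm : ∀ i ≤ n, ‖iteratedFDeriv ℝ i f x‖ * ‖iteratedFDeriv ℝ (n - i) g x‖ ≤
      C * D * B ^ n * (n.factorial : ℝ) ^ s := fun i hi => by
    have hfac : (i.factorial : ℝ) ^ s * ((n - i).factorial : ℝ) ^ s ≤ (n.factorial : ℝ) ^ s := by
      rw [← Real.mul_rpow (by positivity) (by positivity)]
      gcongr
      exact_mod_cast Nat.le_of_dvd n.factorial_pos (Nat.factorial_mul_factorial_dvd_factorial hi)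
    have hpow : B ^ n = B ^ i * B ^ (n - i) := by rw [← pow_add, Nat.add_sub_cancel' hi]
    calc _ ≤ C * B ^ i * (i.factorial : ℝ) ^ s * (D * B ^ (n - i) * ((n - i).factorial : ℝ) ^ s) :=
          mul_le_mul (hfx i) (hgx (n - i)) (norm_nonneg _) ((norm_nonneg _).trans (hfx i))
      _ = C * D * B ^ n * ((i.factorial : ℝ) ^ s * ((n - i).factorial : ℝ) ^ s) := by
          rw [hpow]
          ring
      _ ≤ _ := by gcongr
  calc _ ≤ ∑ i ∈ Finset.range (n + 1), (n.choose i : ℝ) *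
        (C * D * B ^ n * (n.factorial : ℝ) ^ s) := by
        refine (norm_iteratedFDeriv_smul_le hf hg x (by exact_mod_cast le_top)).trans
          (Finset.sum_le_sum fun i hi => ?_)
        rw [mul_assoc]
        exact mul_le_mul_of_nonneg_left (hterm i (Nat.lt_succ_iff.1 (Finset.mem_range.1 hi)))
          (Nat.cast_nonneg _)
    _ = _ := by
        rw [← Finset.sum_mul, ← Nat.cast_sum, Nat.sum_range_choose, mul_pow]
        push_cast
        ring

section Gaussian

variable {E : Type*} [NormedAddCommGroup E]

/-- The Gaussian `e^{-π ‖y‖²}`, normalized so as to be its own Fourier transform. -/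
def gaussian (y : E) : ℂ := Complex.exp (-(π : ℂ) * (‖y‖ : ℂ) ^ 2)

theorem gaussian_eq_ofReal (y : E) : gaussian y = (Real.exp (-π * ‖y‖ ^ 2) : ℝ) := by
  rw [gaussian]
  push_cast
  rfl

theorem norm_gaussian (y : E) : ‖gaussian y‖ = Real.exp (-π * ‖y‖ ^ 2) := by
  rw [gaussian_eq_ofReal, Complex.norm_real, Real.norm_of_nonneg (Real.exp_pos _).le]

theorem continuous_gaussian : Continuous (gaussian : E → ℂ) := by
  unfold gaussian
  fun_prop

theorem norm_gaussian_le_one (y : E) : ‖gaussian y‖ ≤ 1 := by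
  rw [norm_gaussian, Real.exp_le_one_iff]
  nlinarith [Real.pi_pos, sq_nonneg ‖y‖]

theorem norm_gaussian_mul_gevreyWeight_le {s h : ℝ} (hs : 1 ≤ s) (hh : 0 ≤ h) (y : E) :
    ‖gaussian y‖ * gevreyWeight s h y ≤ Real.exp (h + h ^ 2) := by
  refine (mul_le_mul_of_nonneg_left (gevreyWeight_le_exp hs hh y) (norm_nonneg _)).trans ?_
  rw [norm_gaussian, ← Real.exp_add, ← Real.exp_add, Real.exp_le_exp]
  nlinarith [Real.pi_gt_three, sq_nonneg (‖y‖ - h / 2), sq_nonneg h, sq_nonneg ‖y‖]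

theorem eq_exp_smul_mul_gaussian (f : E → ℂ) (x : E) :
    f = fun y => Real.exp (π * ‖y - x‖ ^ 2) • (f y * gaussian (y - x)) := by
  ext y
  rw [gaussian_eq_ofReal, mul_comm (f y), ← Complex.real_smul, smul_smul, ← Real.exp_add]
  simp

variable {V : Type*} [NormedAddCommGroup V] [InnerProductSpace ℝ V]

theorem fderiv_pi_mul_norm_sq :
    fderiv ℝ (fun y : V => π * ‖y‖ ^ 2) =
      ⇑((2 * π) • innerSL ℝ : V →L[ℝ] V →L[ℝ] ℝ) := by
  ext x v
  rw [((hasStrictFDerivAt_norm_sq x).hasFDerivAt.const_mul π).fderiv]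
  simp only [_root_.smul_apply, smul_eq_mul, nsmul_eq_mul]
  push_cast
  ring

theorem norm_iteratedFDeriv_pi_mul_norm_sq_le {n : ℕ} (hn : 1 ≤ n) :
    ‖iteratedFDeriv ℝ n (fun y : V => π * ‖y‖ ^ 2) 0‖ ≤ (2 * π) ^ n := by
  have hπ : 1 ≤ 2 * π := by linarith [Real.pi_gt_three]
  have hL : ‖((2 * π) • innerSL ℝ : V →L[ℝ] V →L[ℝ] ℝ)‖ ≤ 2 * π := by
    refine ContinuousLinearMap.opNorm_le_bound _ (by positivity) fun x => ?_
    rw [_root_.smul_apply, norm_smul, innerSL_apply_norm, Real.norm_of_nonneg (by positivity)]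
  have hL' : fderiv ℝ ((2 * π) • innerSL ℝ : V →L[ℝ] V →L[ℝ] ℝ) = fun _ => (2 * π) • innerSL ℝ :=
    funext fun _ => ContinuousLinearMap.fderiv _
  match n with
  | 1 =>
    rw [← norm_iteratedFDeriv_fderiv, fderiv_pi_mul_norm_sq, norm_iteratedFDeriv_zero, map_zero,
      norm_zero]
    positivity
  | 2 =>
    rw [← norm_iteratedFDeriv_fderiv, fderiv_pi_mul_norm_sq, ← norm_iteratedFDeriv_fderiv, hL',
      norm_iteratedFDeriv_zero]
    exact hL.trans (le_self_pow₀ hπ two_ne_zero)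
  | n + 3 =>
    rw [← norm_iteratedFDeriv_fderiv, fderiv_pi_mul_norm_sq, ← norm_iteratedFDeriv_fderiv, hL',
      iteratedFDeriv_succ_const, Pi.zero_apply, norm_zero]
    positivity

theorem norm_iteratedFDeriv_exp_pi_mul_norm_sq_le (x : V) (n : ℕ) :
    ‖iteratedFDeriv ℝ n (fun y : V => Real.exp (π * ‖y - x‖ ^ 2)) x‖ ≤
      n.factorial * (2 * π) ^ n := by
  rw [iteratedFDeriv_comp_sub (𝕜 := ℝ) (f := fun y : V => Real.exp (π * ‖y‖ ^ 2)) n x x, sub_self]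
  have hexp : ∀ i ≤ n, ‖iteratedFDeriv ℝ i Real.exp (π * ‖(0 : V)‖ ^ 2)‖ ≤ 1 := fun i _ => by
    simp [norm_iteratedFDeriv_eq_norm_iteratedDeriv, iteratedDeriv_eq_iterate, Real.iter_deriv_exp]
  simpa [Function.comp_def] using norm_iteratedFDeriv_comp_le (𝕜 := ℝ) (g := Real.exp) (N := ∞)
    Real.contDiff_exp (contDiff_const.mul (contDiff_norm_sq ℝ)) (by exact_mod_cast le_top) 0 hexp
    fun i hi _ => norm_iteratedFDeriv_pi_mul_norm_sq_le (V := V) hi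

variable [FiniteDimensional ℝ V] [MeasurableSpace V] [BorelSpace V]

theorem fourier_gaussian : 𝓕 (gaussian : V → ℂ) = gaussian := by
  ext ξ
  have hpi : (π : ℂ) ≠ 0 := Complex.ofReal_ne_zero.2 Real.pi_ne_zero
  unfold gaussian
  rw [fourier_gaussian_innerProductSpace (by simpa using Real.pi_pos), div_self hpi,
    Complex.one_cpow, one_mul]
  congr 1
  field_simp

theorem integrable_gaussian : Integrable (gaussian : V → ℂ) := by
  change Integrable fun y : V => Complex.exp (-(π : ℂ) * (‖y‖ : ℂ) ^ 2)
  simpa using GaussianFourier.integrable_cexp_neg_mul_sq_norm_add (V := V) (b := π)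
    (by simpa using Real.pi_pos) 0 0

namespace GevreyIntegrable

variable {s h : ℝ} {f : V → ℂ}

theorem exists_norm_iteratedFDeriv_mul_gaussian_le (hs : 1 ≤ s) (hh : 0 < h)
    (hf : GevreyIntegrable s h f) (hfc : Continuous f) :
    ∃ C : ℝ, ∀ x : V, ContDiff ℝ ∞ (fun y => f y * gaussian (y - x)) ∧
      ∀ (n : ℕ) (y : V), ‖iteratedFDeriv ℝ n (fun y => f y * gaussian (y - x)) y‖ ≤
        C * (2 * π * (h / 4 / s) ^ (-s)) ^ n * (n.factorial : ℝ) ^ s *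
          gevreyWeight s (-(h / 2)) x := by
  have hs0 : 0 < s := by linarith
  have hgauss := norm_gaussian_mul_gevreyWeight_le (E := V) hs hh.le
  obtain ⟨C, hC⟩ := hf.exists_norm_fourier_mul_translate_le hs hh.le integrable_gaussian hgauss
    (by rwa [fourier_gaussian])
  set K := ∫ ξ : V, gevreyWeight s (-(h / 2 - h / 4)) ξ
  refine ⟨C * K, fun x => ?_⟩
  set g : V → ℂ := fun y => f y * gaussian (y - x)
  have hgaussx : Continuous fun y => gaussian (y - x) :=
    continuous_gaussian.comp (continuous_id.sub continuous_const)
  have hg : Integrable g := (hf.integrable hs0.le hh.le).mul_bdd hgaussx.aestronglyMeasurable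
    (.of_forall fun y => norm_gaussian_le_one (y - x))
  have hbound : ∀ ξ, ‖𝓕 g ξ‖ * gevreyWeight s (h / 2) ξ ≤ C * gevreyWeight s (-(h / 2)) x := by
    intro ξ
    rw [← le_div_iff₀ (gevreyWeight_pos s _ ξ), div_eq_mul_inv, ← gevreyWeight_neg_rate, mul_assoc]
    exact hC x ξ
  have hweight := integrable_gevreyWeight_smul_of_norm_le (μ := volume) hs
    (by linarith : h / 4 < h / 2)
    (continuous_fourier_of_integrable hg).aestronglyMeasurable hbound
  have hinv : 𝓕⁻ (𝓕 g) = g := (hfc.mul hgaussx).fourierInv_fourier_eq hg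
    (integrable_of_gevreyWeight_smul hs0.le (by positivity) hweight)
  have hint : ∫ ξ, ‖gevreyWeight s (h / 4) ξ • 𝓕 g ξ‖ ≤ C * gevreyWeight s (-(h / 2)) x * K := by
    rw [← integral_const_mul]
    exact integral_mono hweight.norm
      ((integrable_gevreyWeight hs (by linarith : 0 < h / 2 - h / 4)).const_mul _)
      fun ξ => norm_gevreyWeight_smul_le _ (hbound ξ)
  refine ⟨hinv ▸ contDiff_fourierInv_of_gevreyWeight_smul hs0 (by positivity) hweight,
    fun n y => ?_⟩
  calc ‖iteratedFDeriv ℝ n g y‖ = ‖iteratedFDeriv ℝ n (𝓕⁻ (𝓕 g)) y‖ := by rw [hinv]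
    _ ≤ (2 * π * (h / 4 / s) ^ (-s)) ^ n * (n.factorial : ℝ) ^ s *
          (C * gevreyWeight s (-(h / 2)) x * K) :=
        (norm_iteratedFDeriv_fourierInv_le_of_gevreyWeight_smul hs0 (by positivity) hweight n
          y).trans (by gcongr)
    _ = _ := by ring

theorem exists_norm_iteratedFDeriv_le (hs : 1 < s) (hh : 0 < h) (hf : GevreyIntegrable s h f)
    (hfc : Continuous f) : ∃ C : ℝ, 0 ≤ C ∧ ∀ (n : ℕ) (x : V), ‖iteratedFDeriv ℝ n f x‖ ≤
      C * (4 * π * (h / 4 / s) ^ (-s)) ^ n * (n.factorial : ℝ) ^ s *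
        gevreyWeight s (-(h / 2)) x := by
  have hs0 : 0 < s := by linarith
  obtain ⟨C, hC⟩ := hf.exists_norm_iteratedFDeriv_mul_gaussian_le hs.le hh hfc
  obtain ⟨D, hD⟩ := exists_factorial_mul_pow_le hs (by positivity : 0 ≤ 2 * π)
    (by positivity : 0 < 2 * π * (h / 4 / s) ^ (-s))
  have hC0 : 0 ≤ C := by
    simpa [gevreyWeight_pos] using (norm_nonneg _).trans ((hC 0).2 0 0)
  have hD0 : 0 ≤ D := zero_le_one.trans (by simpa using hD 0)
  refine ⟨D * C, by positivity, fun n x => ?_⟩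
  have hexp : ContDiff ℝ ∞ fun y : V => Real.exp (π * ‖y - x‖ ^ 2) :=
    Real.contDiff_exp.comp
      (contDiff_const.mul ((contDiff_norm_sq ℝ).comp (contDiff_id.sub contDiff_const)))
  have hw : 0 ≤ C * gevreyWeight s (-(h / 2)) x := mul_nonneg hC0 (gevreyWeight_pos s _ x).le
  have hprod := norm_iteratedFDeriv_smul_le_of_factorial hs0.le (by positivity) hD0 hw hexp
    (hC x).1 (fun n => (norm_iteratedFDeriv_exp_pi_mul_norm_sq_le x n).trans (hD n))
    (fun n => ((hC x).2 n x).trans_eq (by ring)) n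
  rw [← eq_exp_smul_mul_gaussian f x] at hprod
  exact hprod.trans_eq (by ring)

end GevreyIntegrable

end Gaussian

/-! ### The Gelfand-Shilov norms -/

section GelfandShilov

variable {d : ℕ} {s : ℝ} {f : Rd d → ℂ}

theorem gsNorm_lt_top_iff {H : ℝ} (hH : 0 < H) :
    gsNorm s H f < ⊤ ↔ ∃ C : ℝ, ∀ (α β : Fin d → ℕ) (x : Rd d),
      ‖((∏ i, x i ^ α i : ℝ) : ℂ) * multiDeriv β f x‖ ≤ C * (H ^ (∑ i, (α i + β i)) *
        (((∏ i, (α i).factorial) * (∏ i, (β i).factorial) : ℕ) : ℝ) ^ s) := by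
  have hfac : ∀ α β : Fin d → ℕ,
      (0 : ℝ) < (((∏ i, (α i).factorial) * (∏ i, (β i).factorial) : ℕ) : ℝ) := fun α β => by
    positivity
  have hpos : ∀ α β : Fin d → ℕ, 0 < H ^ (∑ i, (α i + β i)) *
      (((∏ i, (α i).factorial) * (∏ i, (β i).factorial) : ℕ) : ℝ) ^ s := fun α β =>
    mul_pos (pow_pos hH _) (Real.rpow_pos_of_pos (hfac α β) s)
  constructor
  · intro hf
    refine ⟨(gsNorm s H f).toReal, fun α β x => ?_⟩
    rw [← div_le_iff₀ (hpos α β)]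
    exact (ENNReal.ofReal_le_iff_le_toReal hf.ne).1
      (le_iSup_of_le α (le_iSup_of_le β (le_iSup_of_le x le_rfl)))
  · rintro ⟨C, hC⟩
    refine lt_of_le_of_lt (iSup_le fun α => iSup_le fun β => iSup_le fun x =>
      ENNReal.ofReal_le_ofReal ?_) (ENNReal.ofReal_lt_top (r := C))
    rw [div_le_iff₀ (hpos α β)]
    exact hC α β x

theorem contDiff_partialDeriv (hf : ContDiff ℝ ∞ f) (i : Fin d) :
    ContDiff ℝ ∞ (partialDeriv i f) :=
  (hf.fderiv_right (by simp)).clm_apply contDiff_const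

theorem contDiff_iterate_partialDeriv (hf : ContDiff ℝ ∞ f) (i : Fin d) (n : ℕ) :
    ContDiff ℝ ∞ ((partialDeriv i)^[n] f) := by
  induction n with
  | zero => exact hf
  | succ n ih =>
    rw [Function.iterate_succ_apply']
    exact contDiff_partialDeriv ih i

theorem norm_iteratedFDeriv_partialDeriv_le (hf : ContDiff ℝ ∞ f) (i : Fin d) (n : ℕ) (x : Rd d) :
    ‖iteratedFDeriv ℝ n (partialDeriv i f) x‖ ≤ ‖iteratedFDeriv ℝ (n + 1) f x‖ := by
  rw [← norm_iteratedFDeriv_fderiv]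
  simpa [← partialDeriv.eq_def] using
    norm_iteratedFDeriv_clm_apply_const (c := EuclideanSpace.single i (1 : ℝ)) (n := n)
      (hf.fderiv_right (m := ∞) (by simp)).contDiffAt (by exact_mod_cast le_top)

theorem norm_iteratedFDeriv_iterate_partialDeriv_le (hf : ContDiff ℝ ∞ f) (i : Fin d)
    (n k : ℕ) (x : Rd d) :
    ‖iteratedFDeriv ℝ n ((partialDeriv i)^[k] f) x‖ ≤ ‖iteratedFDeriv ℝ (n + k) f x‖ := by
  induction k generalizing n with
  | zero => rfl
  | succ k ih =>
    rw [Function.iterate_succ_apply', add_comm k, ← add_assoc]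
    exact (norm_iteratedFDeriv_partialDeriv_le (contDiff_iterate_partialDeriv hf i k) i n x).trans
      (ih (n + 1))

theorem norm_multiDeriv_le (hf : ContDiff ℝ ∞ f) (β : Fin d → ℕ) (x : Rd d) :
    ‖multiDeriv β f x‖ ≤ ‖iteratedFDeriv ℝ (∑ i, β i) f x‖ := by
  have key : ∀ l : List (Fin d), ContDiff ℝ ∞ (l.foldr (fun i g => (partialDeriv i)^[β i] g) f) ∧
      ∀ n, ‖iteratedFDeriv ℝ n (l.foldr (fun i g => (partialDeriv i)^[β i] g) f) x‖ ≤
        ‖iteratedFDeriv ℝ (n + (l.map β).sum) f x‖ := by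
    intro l
    induction l with
    | nil => exact ⟨hf, fun n => le_rfl⟩
    | cons i l ih =>
      refine ⟨contDiff_iterate_partialDeriv ih.1 i (β i), fun n => ?_⟩
      rw [List.map_cons, List.sum_cons, ← add_assoc]
      exact (norm_iteratedFDeriv_iterate_partialDeriv_le ih.1 i n (β i) x).trans (ih.2 (n + β i))
  have hnorm := (key (List.finRange d)).2 0
  rwa [norm_iteratedFDeriv_zero, zero_add, ← List.ofFn_eq_map, List.sum_ofFn] at hnorm

theorem multiDeriv_zero (f : Rd d → ℂ) : multiDeriv 0 f = f :=
  List.foldr_fixed' (fun _ => rfl) (List.finRange d)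

theorem multiDeriv_single (k : Fin d) (n : ℕ) (f : Rd d → ℂ) :
    multiDeriv (Pi.single k n) f = (partialDeriv k)^[n] f := by
  have key : ∀ l : List (Fin d), l.Nodup →
      l.foldr (fun i g => (partialDeriv i)^[(Pi.single k n : Fin d → ℕ) i] g) f =
        if k ∈ l then (partialDeriv k)^[n] f else f := by
    intro l hl
    induction l with
    | nil => simp
    | cons i l ih =>
      rw [List.nodup_cons] at hl
      rw [List.foldr_cons, ih hl.2]
      rcases eq_or_ne i k with rfl | hik
      · simp [hl.1]
      · simp [hik, hik.symm]
  simpa [multiDeriv] using key (List.finRange d) (List.nodup_finRange d)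

theorem norm_prod_pow_le (x : Rd d) (α : Fin d → ℕ) :
    ‖((∏ i, x i ^ α i : ℝ) : ℂ)‖ ≤ ‖x‖ ^ ∑ i, α i := by
  rw [Complex.norm_real, norm_prod, ← Finset.prod_pow_eq_pow_sum]
  refine Finset.prod_le_prod (fun _ _ => norm_nonneg _) fun i _ => ?_
  rw [norm_pow]
  exact pow_le_pow_left₀ (norm_nonneg _) (PiLp.norm_apply_le x i) _

theorem factorial_sum_le_pow_mul_prod {ι : Type*} [Fintype ι] (α : ι → ℕ) :
    (∑ i, α i).factorial ≤ Fintype.card ι ^ (∑ i, α i) * ∏ i, (α i).factorial := by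
  classical
  have hle : Nat.multinomial Finset.univ α ≤ Fintype.card ι ^ (∑ i, α i) := by
    have hsum := Finset.sum_pow_eq_sum_piAntidiag (Finset.univ : Finset ι) (fun _ => (1 : ℕ))
      (∑ i, α i)
    simp only [Finset.sum_const, Finset.card_univ, smul_eq_mul, mul_one, one_pow,
      Finset.prod_const_one] at hsum
    rw [hsum]
    exact Finset.single_le_sum (f := fun k => ((Nat.multinomial Finset.univ k : ℕ) : ℕ))
      (fun _ _ => Nat.zero_le _) (by simp [Finset.mem_piAntidiag])
  rw [← Nat.multinomial_spec, mul_comm]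
  exact Nat.mul_le_mul_right _ hle

theorem rpow_factorial_sum_le (hs : 0 ≤ s) (α : Fin d → ℕ) :
    ((∑ i, α i).factorial : ℝ) ^ s ≤
      (((d : ℝ) + 1) ^ s) ^ (∑ i, α i) * ((∏ i, (α i).factorial : ℕ) : ℝ) ^ s := by
  have hle : ((∑ i, α i).factorial : ℝ) ≤
      ((d : ℝ) + 1) ^ (∑ i, α i) * ((∏ i, (α i).factorial : ℕ) : ℝ) := by
    have hcard := factorial_sum_le_pow_mul_prod α
    rw [Fintype.card_fin] at hcard
    exact_mod_cast hcard.trans (by gcongr; omega)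
  calc _ ≤ (((d : ℝ) + 1) ^ (∑ i, α i) * ((∏ i, (α i).factorial : ℕ) : ℝ)) ^ s := by gcongr
    _ = _ := by
        rw [Real.mul_rpow (by positivity) (by positivity), Real.rpow_pow_comm (by positivity)]

theorem gsNorm_lt_top_of_norm_iteratedFDeriv_le {k B C : ℝ} (hs : 0 < s) (hk : 0 < k)
    (hB : (k / s) ^ (-s) ≤ B) (hf : ContDiff ℝ ∞ f)
    (hC : ∀ n x, ‖iteratedFDeriv ℝ n f x‖ ≤
      C * B ^ n * (n.factorial : ℝ) ^ s * gevreyWeight s (-k) x) :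
    gsNorm s (B * ((d : ℝ) + 1) ^ s) f < ⊤ := by
  have hB0 : 0 < B := lt_of_lt_of_le (by positivity) hB
  have hC0 : 0 ≤ C := by simpa [gevreyWeight_pos] using (norm_nonneg _).trans (hC 0 0)
  refine (gsNorm_lt_top_iff (by positivity)).2 ⟨C, fun α β x => ?_⟩
  set m := ∑ i, α i
  set n := ∑ i, β i
  have hderiv : ‖gevreyWeight s k x • multiDeriv β f x‖ ≤ C * B ^ n * (n.factorial : ℝ) ^ s := by
    rw [norm_smul, norm_gevreyWeight, ← le_div_iff₀' (gevreyWeight_pos s k x), div_eq_mul_inv,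
      ← gevreyWeight_neg_rate]
    exact (norm_multiDeriv_le hf β x).trans (hC n x)
  have hα := rpow_factorial_sum_le hs.le α
  have hβ := rpow_factorial_sum_le hs.le β
  calc _ ≤ ‖x‖ ^ m * ‖multiDeriv β f x‖ := by
        rw [norm_mul]
        gcongr
        exact norm_prod_pow_le x α
    _ ≤ B ^ m * (m.factorial : ℝ) ^ s * (C * B ^ n * (n.factorial : ℝ) ^ s) :=
        (pow_mul_norm_le_gevreyWeight_smul hs hk (multiDeriv β f) m x).trans (by gcongr)
    _ ≤ B ^ m * ((((d : ℝ) + 1) ^ s) ^ m * ((∏ i, (α i).factorial : ℕ) : ℝ) ^ s) *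
          (C * B ^ n * ((((d : ℝ) + 1) ^ s) ^ n * ((∏ i, (β i).factorial : ℕ) : ℝ) ^ s)) := by
        gcongr
    _ = _ := by
        rw [Finset.sum_add_distrib, pow_add, mul_pow, mul_pow, Nat.cast_mul,
          Real.mul_rpow (Nat.cast_nonneg _) (Nat.cast_nonneg _)]
        ring

/-- The index `H` of a Gelfand-Shilov norm that is finite for all smooth functions with
`GevreyIntegrable s h`. -/
def gsIndex (d : ℕ) (s h : ℝ) : ℝ := 4 * π * (h / 4 / s) ^ (-s) * ((d : ℝ) + 1) ^ s

theorem GevreyIntegrable.gsNorm_lt_top {h : ℝ} (hs : 1 < s) (hh : 0 < h)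
    (hf : GevreyIntegrable s h f) (hfs : ContDiff ℝ ∞ f) : gsNorm s (gsIndex d s h) f < ⊤ := by
  have hs0 : 0 < s := by linarith
  obtain ⟨C, -, hC⟩ := hf.exists_norm_iteratedFDeriv_le hs hh hfs.continuous
  refine gsNorm_lt_top_of_norm_iteratedFDeriv_le hs0 (half_pos hh) ?_ hfs hC
  calc (h / 2 / s) ^ (-s) ≤ (h / 4 / s) ^ (-s) :=
        Real.rpow_le_rpow_of_nonpos (by positivity) (by gcongr; norm_num) (by linarith)
    _ ≤ 4 * π * (h / 4 / s) ^ (-s) :=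
        le_mul_of_one_le_left (by positivity) (by linarith [Real.pi_gt_three])

theorem exists_gsIndex_eq (d : ℕ) {H : ℝ} (hs : 0 < s) (hH : 0 < H) :
    ∃ h : ℝ, 0 < h ∧ gsIndex d s h = H := by
  refine ⟨4 * s * (H / (4 * π * ((d : ℝ) + 1) ^ s)) ^ (-(1 / s)), by positivity, ?_⟩
  have hbase : 4 * s * (H / (4 * π * ((d : ℝ) + 1) ^ s)) ^ (-(1 / s)) / 4 / s =
      (H / (4 * π * ((d : ℝ) + 1) ^ s)) ^ (-(1 / s)) := by field_simp
  rw [gsIndex, hbase, ← Real.rpow_mul (by positivity), neg_mul_neg, one_div_mul_cancel hs.ne',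
    Real.rpow_one]
  field_simp

end GelfandShilov

/-! ### Decay of functions with a finite Gelfand-Shilov norm -/

section FourierLineDeriv

variable {V : Type*} [NormedAddCommGroup V] [InnerProductSpace ℝ V] [FiniteDimensional ℝ V]
  [MeasurableSpace V] [BorelSpace V]

theorem fourier_eq_mul_of_hasLineDerivAt {f f' : V → ℂ} {v : V} (hf : Integrable f)
    (hf' : Integrable f') (hderiv : ∀ x, HasLineDerivAt ℝ f (f' x) x v) (ξ : V) :
    𝓕 f' ξ = 2 * π * Complex.I * ⟪v, ξ⟫_ℝ * 𝓕 f ξ := by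
  set e : V → ℂ := fun x => Complex.exp ((-2 * π * ⟪x, ξ⟫_ℝ : ℝ) * Complex.I)
  have he : ∀ x, HasLineDerivAt ℝ e (-(2 * π * Complex.I * ⟪v, ξ⟫_ℝ) * e x) x v := by
    intro x
    have hphase : HasDerivAt (fun t : ℝ => -2 * π * ⟪x + t • v, ξ⟫_ℝ) (-2 * π * ⟪v, ξ⟫_ℝ) 0 := by
      simp only [inner_add_left, real_inner_smul_left]
      simpa using (((hasDerivAt_id (0 : ℝ)).mul_const ⟪v, ξ⟫_ℝ).const_add ⟪x, ξ⟫_ℝ).const_mul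
        (-2 * π)
    refine (hphase.ofReal_comp.mul_const Complex.I).cexp.congr_deriv ?_
    simp only [e, zero_smul, add_zero]
    push_cast
    ring
  have hint : ∀ g : V → ℂ, Integrable g → Integrable fun x => e x * g x := fun g hg =>
    hg.bdd_mul (c := 1) (by fun_prop : Continuous e).aestronglyMeasurable
      (.of_forall fun x => (Complex.norm_exp_ofReal_mul_I _).le)
  have hparts := integral_bilinear_hasLineDerivAt_right_eq_neg_left_of_integrable (μ := volume)
    (B := ContinuousLinearMap.mul ℝ ℂ)
    (by simpa [mul_assoc] using (hint f hf).const_mul (-(2 * π * Complex.I * ⟪v, ξ⟫_ℝ)))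
    (by simpa using hint f' hf') (by simpa using hint f hf)
    (fun x _ => he x) (fun x _ => hderiv x)
  simp only [ContinuousLinearMap.mul_apply', mul_assoc, integral_const_mul] at hparts
  rw [Real.fourier_eq', Real.fourier_eq']
  change ∫ x, e x * f' x = _ * ∫ x, e x * f x
  rw [hparts]
  ring

theorem norm_fourier_le_of_mul_gevreyWeight_le {s h C : ℝ} {f : V → ℂ} (hs : 1 ≤ s) (hh : 0 < h)
    (hC : ∀ x, ‖f x‖ * gevreyWeight s h x ≤ C) (ξ : V) :
    ‖𝓕 f ξ‖ ≤ C * ∫ x : V, gevreyWeight s (-h) x := by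
  refine (norm_fourier_le_integral f ξ).trans ?_
  rw [← integral_const_mul]
  refine integral_mono_of_nonneg (.of_forall fun _ => norm_nonneg _)
    ((integrable_gevreyWeight hs hh).const_mul C) (.of_forall fun x => ?_)
  simpa [gevreyWeight_neg_rate, ← div_eq_mul_inv, le_div_iff₀ (gevreyWeight_pos s h x)] using hC x

end FourierLineDeriv

theorem mul_exp_rpow_le_of_forall_pow {s t a C H : ℝ} (hs : 0 < s) (ht : 0 ≤ t) (ha : 0 ≤ a)
    (hC : 0 ≤ C) (hH : 0 < H) (h : ∀ m : ℕ, t ^ m * a ≤ C * H ^ m * (m.factorial : ℝ) ^ s) :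
    a * Real.exp (s / 2 * H ^ (-(1 / s)) * t ^ (1 / s)) ≤ C * 2 ^ s := by
  set y := (t / H) ^ (1 / s) * (1 / 2)
  have hroot : ∀ {r : ℝ}, 0 ≤ r → (r ^ (1 / s)) ^ s = r := fun hr => by
    rw [one_div, Real.rpow_inv_rpow hr hs.ne']
  have hterm : ∀ m : ℕ, a ^ (1 / s) * (y ^ m / m.factorial) ≤ C ^ (1 / s) * (1 / 2) ^ m := by
    intro m
    have hy : (y ^ m) ^ s = t ^ m / H ^ m * ((1 / 2) ^ m) ^ s := by
      rw [mul_pow, Real.mul_rpow (by positivity) (by positivity), ← Real.rpow_pow_comm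
        (by positivity), hroot (by positivity), div_pow]
    rw [← mul_div_assoc, div_le_iff₀ (by positivity),
      ← Real.rpow_le_rpow_iff (by positivity) (by positivity) hs]
    calc (a ^ (1 / s) * y ^ m) ^ s = t ^ m * a / H ^ m * ((1 / 2) ^ m) ^ s := by
          rw [Real.mul_rpow (by positivity) (by positivity), hroot ha, hy]
          ring
      _ ≤ C * (m.factorial : ℝ) ^ s * ((1 / 2) ^ m) ^ s := by
          gcongr
          rw [div_le_iff₀ (by positivity)]
          exact (h m).trans_eq (by ring)
      _ = (C ^ (1 / s) * (1 / 2) ^ m * m.factorial) ^ s := by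
          rw [Real.mul_rpow (by positivity) (by positivity),
            Real.mul_rpow (by positivity) (by positivity), hroot hC]
          ring
  have hsum : a ^ (1 / s) * Real.exp y ≤ C ^ (1 / s) * 2 := by
    rw [Real.exp_eq_exp_ℝ]
    exact hasSum_le hterm ((NormedSpace.expSeries_div_hasSum_exp y).mul_left _)
      (hasSum_geometric_two.mul_left _)
  have hys : s / 2 * H ^ (-(1 / s)) * t ^ (1 / s) = y * s := by
    simp only [y, Real.div_rpow ht hH.le, Real.rpow_neg hH.le]
    ring
  calc a * Real.exp (s / 2 * H ^ (-(1 / s)) * t ^ (1 / s)) = (a ^ (1 / s) * Real.exp y) ^ s := by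
        rw [Real.mul_rpow (by positivity) (by positivity), hroot ha, ← Real.exp_mul, hys]
    _ ≤ (C ^ (1 / s) * 2) ^ s := by gcongr
    _ = C * 2 ^ s := by rw [Real.mul_rpow (by positivity) (by positivity), hroot hC]

section MomentDecay

variable {d : ℕ} {s : ℝ}

theorem exists_norm_le_mul_abs_apply [Nonempty (Fin d)] (x : Rd d) :
    ∃ j, ‖x‖ ≤ (d + 1) * |x j| := by
  obtain ⟨j, -, hj⟩ := Finset.exists_max_image Finset.univ (fun i => |x i|) Finset.univ_nonempty
  refine ⟨j, ?_⟩
  refine (sq_le_sq₀ (norm_nonneg x) (by positivity)).1 ?_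
  calc ‖x‖ ^ 2 = ∑ i, |x i| ^ 2 := by simp [EuclideanSpace.norm_sq_eq]
    _ ≤ ∑ _i : Fin d, |x j| ^ 2 := Finset.sum_le_sum fun i hi =>
        pow_le_pow_left₀ (abs_nonneg _) (hj i hi) 2
    _ ≤ ((d + 1) * |x j|) ^ 2 := by
        simp only [Finset.sum_const, Finset.card_univ, Fintype.card_fin, nsmul_eq_mul, mul_pow]
        gcongr
        nlinarith [Nat.cast_nonneg (α := ℝ) d]

/-- The rate of decay that results from moment bounds with constant `H`. -/
def decayRate (d : ℕ) (s H : ℝ) : ℝ := s / 2 * (((d : ℝ) + 1) * H) ^ (-(1 / s))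

theorem exists_decayRate_eq (d : ℕ) {h : ℝ} (hs : 0 < s) (hh : 0 < h) :
    ∃ H : ℝ, 0 < H ∧ decayRate d s H = h := by
  refine ⟨(h / (s / 2)) ^ (-s) / (d + 1), by positivity, ?_⟩
  rw [decayRate, mul_div_cancel₀ _ (by positivity), ← Real.rpow_mul (by positivity), neg_mul_neg,
    mul_one_div_cancel hs.ne', Real.rpow_one]
  field_simp

theorem decayRate_pos (d : ℕ) {H : ℝ} (hs : 0 < s) (hH : 0 < H) : 0 < decayRate d s H := by
  unfold decayRate
  positivity

theorem mul_gevreyWeight_decayRate_le {H C a : ℝ} {x : Rd d} (hs : 0 < s) (hH : 0 < H)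
    (ha : 0 ≤ a) (hC : a ≤ C)
    (hmoment : ∀ j (m : ℕ), |x j| ^ m * a ≤ C * H ^ m * (m.factorial : ℝ) ^ s) :
    a * gevreyWeight s (decayRate d s H) x ≤ C * 2 ^ s := by
  have hC0 : 0 ≤ C := ha.trans hC
  refine mul_exp_rpow_le_of_forall_pow hs (norm_nonneg x) ha hC0 (by positivity) fun m => ?_
  rcases isEmpty_or_nonempty (Fin d) with hd | hd
  · rcases eq_or_ne m 0 with rfl | hm
    · simpa using hC
    · rw [Subsingleton.elim x 0, norm_zero, zero_pow hm, zero_mul]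
      positivity
  · obtain ⟨j, hj⟩ := exists_norm_le_mul_abs_apply x
    calc ‖x‖ ^ m * a ≤ (((d : ℝ) + 1) * |x j|) ^ m * a := by gcongr
      _ = ((d : ℝ) + 1) ^ m * (|x j| ^ m * a) := by rw [mul_pow, mul_assoc]
      _ ≤ ((d : ℝ) + 1) ^ m * (C * H ^ m * (m.factorial : ℝ) ^ s) :=
          mul_le_mul_of_nonneg_left (hmoment j m) (by positivity)
      _ = C * (((d : ℝ) + 1) * H) ^ m * (m.factorial : ℝ) ^ s := by
          rw [mul_pow]
          ring

theorem norm_multiDeriv_mul_gevreyWeight_le {H C : ℝ} {f : Rd d → ℂ} (hs : 0 < s) (hH : 0 < H)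
    (hC : ∀ (α β : Fin d → ℕ) (x : Rd d),
      ‖((∏ i, x i ^ α i : ℝ) : ℂ) * multiDeriv β f x‖ ≤ C * (H ^ (∑ i, (α i + β i)) *
        (((∏ i, (α i).factorial) * (∏ i, (β i).factorial) : ℕ) : ℝ) ^ s))
    (β : Fin d → ℕ) (x : Rd d) :
    ‖multiDeriv β f x‖ * gevreyWeight s (decayRate d s H) x ≤
      C * (H ^ (∑ i, β i) * ((∏ i, (β i).factorial : ℕ) : ℝ) ^ s) * 2 ^ s := by
  refine mul_gevreyWeight_decayRate_le hs hH (norm_nonneg _) (by simpa using hC 0 β x)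
    fun j m => ?_
  have hpow : ∏ i, x i ^ (Pi.single j m : Fin d → ℕ) i = x j ^ m := by
    rw [Fintype.prod_eq_single j fun i hi => by simp [hi], Pi.single_eq_same]
  have hfac : ∏ i, ((Pi.single j m : Fin d → ℕ) i).factorial = m.factorial := by
    rw [Fintype.prod_eq_single j fun i hi => by simp [hi], Pi.single_eq_same]
  have hsum : ∑ i, (Pi.single j m : Fin d → ℕ) i = m := by simp
  have hj := hC (Pi.single j m) β x
  rw [hpow, hfac, Finset.sum_add_distrib, hsum, norm_mul, Complex.norm_real, norm_pow,
    Real.norm_eq_abs, pow_add, Nat.cast_mul,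
    Real.mul_rpow (Nat.cast_nonneg _) (Nat.cast_nonneg _)] at hj
  exact hj.trans_eq (by ring)

theorem norm_fourier_iterate_partialDeriv {f : Rd d → ℂ} (hf : ContDiff ℝ ∞ f)
    (k : Fin d) (hi : ∀ n : ℕ, Integrable ((partialDeriv k)^[n] f)) (ξ : Rd d) (n : ℕ) :
    ‖𝓕 ((partialDeriv k)^[n] f) ξ‖ = (2 * π * |ξ k|) ^ n * ‖𝓕 f ξ‖ := by
  induction n with
  | zero => simp
  | succ n ih =>
    have hderiv : ∀ x, HasLineDerivAt ℝ ((partialDeriv k)^[n] f) ((partialDeriv k)^[n + 1] f x) x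
        (EuclideanSpace.single k 1) := fun x => by
      rw [Function.iterate_succ_apply']
      exact ((contDiff_iterate_partialDeriv hf k n).differentiable (by simp)
        x).hasFDerivAt.hasLineDerivAt _
    rw [fourier_eq_mul_of_hasLineDerivAt (hi n) (hi (n + 1)) hderiv, norm_mul, ih]
    simp only [norm_mul, Complex.norm_ofNat, Complex.norm_real, Complex.norm_I,
      Real.norm_eq_abs, abs_of_pos Real.pi_pos, EuclideanSpace.inner_single_left, map_one, one_mul]
    ring

theorem norm_fourier_mul_gevreyWeight_le {H r C : ℝ} {f : Rd d → ℂ} (hs : 1 ≤ s) (hH : 0 < H)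
    (hr : 0 < r) (hf : ContDiff ℝ ∞ f)
    (hC : ∀ (β : Fin d → ℕ) (x : Rd d), ‖multiDeriv β f x‖ * gevreyWeight s r x ≤
      C * (H ^ (∑ i, β i) * ((∏ i, (β i).factorial : ℕ) : ℝ) ^ s)) (ξ : Rd d) :
    ‖𝓕 f ξ‖ * gevreyWeight s (decayRate d s H) ξ ≤
      C * (∫ x : Rd d, gevreyWeight s (-r) x) * 2 ^ s := by
  have hs0 : 0 < s := by linarith
  have hderiv : ∀ k n (x : Rd d), ‖(partialDeriv k)^[n] f x‖ * gevreyWeight s r x ≤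
      C * (H ^ n * (n.factorial : ℝ) ^ s) := fun k n x => by
    have hfac : ∏ i, ((Pi.single k n : Fin d → ℕ) i).factorial = n.factorial := by
      rw [Fintype.prod_eq_single k fun i hi => by simp [hi], Pi.single_eq_same]
    have hsum : ∑ i, (Pi.single k n : Fin d → ℕ) i = n := by simp
    simpa only [multiDeriv_single, hfac, hsum] using hC (Pi.single k n) x
  have hint : ∀ k n, Integrable ((partialDeriv k)^[n] f) := fun k n =>
    integrable_of_gevreyWeight_smul hs0.le le_rfl (integrable_gevreyWeight_smul_of_norm_le hs hr
      (contDiff_iterate_partialDeriv hf k n).continuous.aestronglyMeasurable (hderiv k n))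
  refine mul_gevreyWeight_decayRate_le hs0 hH (norm_nonneg _)
    (norm_fourier_le_of_mul_gevreyWeight_le hs hr
      (fun x => by simpa [multiDeriv_zero] using hC 0 x) ξ) fun k n => ?_
  calc |ξ k| ^ n * ‖𝓕 f ξ‖ ≤ (2 * π * |ξ k|) ^ n * ‖𝓕 f ξ‖ := by
        gcongr
        exact le_mul_of_one_le_left (abs_nonneg _) (by linarith [Real.pi_gt_three])
    _ = ‖𝓕 ((partialDeriv k)^[n] f) ξ‖ :=
        (norm_fourier_iterate_partialDeriv hf k (hint k) ξ n).symm
    _ ≤ C * (H ^ n * (n.factorial : ℝ) ^ s) * ∫ x : Rd d, gevreyWeight s (-r) x :=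
        norm_fourier_le_of_mul_gevreyWeight_le hs hr (hderiv k n) ξ
    _ = _ := by ring

theorem weightBound_of_gsNorm_lt_top {H : ℝ} {f : Rd d → ℂ} (hs : 1 ≤ s) (hH : 0 < H)
    (hf : ContDiff ℝ ∞ f) (hgs : gsNorm s H f < ⊤) :
    WeightBound s (decayRate d s H) f ∧ WeightBound s (decayRate d s H) (𝓕 f) := by
  have hs0 : 0 < s := by linarith
  obtain ⟨C, hC⟩ := (gsNorm_lt_top_iff hH).1 hgs
  have hderiv := norm_multiDeriv_mul_gevreyWeight_le hs0 hH hC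
  have hfourier := norm_fourier_mul_gevreyWeight_le (C := C * 2 ^ s) hs hH
    (decayRate_pos d hs0 hH) hf fun β x => (hderiv β x).trans_eq (by ring)
  exact ⟨⟨_, fun x => multiDeriv_zero f ▸ hderiv 0 x⟩, ⟨_, hfourier⟩⟩

end MomentDecay

/-! ### Test functions and the functions they determine -/

section TestFunctions

variable {d : ℕ}

theorem gevreyWeight_one {E : Type*} [NormedAddCommGroup E] (h : ℝ) (x : E) :
    gevreyWeight 1 h x = Real.exp (h * ‖x‖) := by
  rw [gevreyWeight, div_one, Real.rpow_one]

theorem ExpBound.weightBound {s h : ℝ} {f : Rd d → ℂ} (hf : ExpBound h f) (hs : 1 ≤ s)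
    (hh : 0 ≤ h) : WeightBound s h f := by
  obtain ⟨C, hC⟩ := hf
  refine ⟨Real.exp h * C, fun x => ?_⟩
  calc ‖f x‖ * gevreyWeight s h x
      ≤ ‖f x‖ * (Real.exp h * Real.exp (h * ‖x‖)) := by gcongr; exact gevreyWeight_le_exp hs hh x
    _ = Real.exp h * (‖f x‖ * Real.exp (h * ‖x‖)) := by ring
    _ ≤ Real.exp h * C := by gcongr; exact hC x

theorem Sigma1.continuous (φ : Sigma1 d) : Continuous φ.toFun := φ.isSigma1.1.continuous

theorem Sigma1.integrable (φ : Sigma1 d) : Integrable φ.toFun := φ.isSigma1.integrable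

theorem WeightBound.gevreyIntegrable {s h k : ℝ} {f : Rd d → ℂ} (hs : 1 ≤ s) (hk : 0 ≤ k)
    (hkh : k < h) (hfm : AEStronglyMeasurable f) (hf : WeightBound s h f)
    (hf' : WeightBound s h (𝓕 f)) : GevreyIntegrable s k f := by
  obtain ⟨C, hC⟩ := hf
  obtain ⟨D, hD⟩ := hf'
  have hwf := integrable_gevreyWeight_smul_of_norm_le hs hkh hfm hC
  have hfi : Integrable f := integrable_of_gevreyWeight_smul (zero_le_one.trans hs) hk hwf
  exact ⟨hwf, integrable_gevreyWeight_smul_of_norm_le hs hkh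
    (continuous_fourier_of_integrable hfi).aestronglyMeasurable hD⟩

theorem Sigma1.gevreyIntegrable (φ : Sigma1 d) {s h : ℝ} (hs : 1 ≤ s) (hh : 0 ≤ h) :
    GevreyIntegrable s h φ.toFun := by
  obtain ⟨hφ, hφ'⟩ := φ.isSigma1.2 (h + 1) (by positivity)
  exact WeightBound.gevreyIntegrable hs hh (lt_add_one h) φ.continuous.aestronglyMeasurable
    (hφ.weightBound hs (by positivity)) (hφ'.weightBound hs (by positivity))

/-- The inverse Fourier transform of a test function. -/
def Sigma1.fourierInv (φ : Sigma1 d) : Sigma1 d :=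
  ⟨𝓕⁻ φ.toFun, by
    have hneg : 𝓕⁻ φ.toFun = fun x => 𝓕 φ.toFun (-x) :=
      funext fun x => Real.fourierInv_eq_fourier_neg _ _
    have hinv : 𝓕 (𝓕⁻ φ.toFun) = φ.toFun :=
      φ.continuous.fourier_fourierInv_eq φ.integrable φ.isSigma1.fourier.integrable
    refine ⟨hneg ▸ φ.isSigma1.contDiff_fourier.comp contDiff_neg, fun h hh => ⟨?_, ?_⟩⟩
    · exact (φ.isSigma1.2 h hh).2.reflect fun x => by rw [hneg]
    · rw [hinv]
      exact (φ.isSigma1.2 h hh).1⟩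

theorem Sigma1.fourier_fourierInv (φ : Sigma1 d) : Sigma1.fourier d φ.fourierInv = φ :=
  Subtype.ext (φ.continuous.fourier_fourierInv_eq φ.integrable φ.isSigma1.fourier.integrable)

theorem Sigma1.fourierInv_fourier (φ : Sigma1 d) : (Sigma1.fourier d φ).fourierInv = φ :=
  Subtype.ext (φ.continuous.fourierInv_fourier_eq φ.integrable φ.isSigma1.fourier.integrable)

theorem Sigma1.exists_ne_zero {φ : Sigma1 d} (hφ : φ ≠ 0) : ∃ y, φ.toFun y ≠ 0 := by
  by_contra! h
  exact hφ (Subtype.ext (funext h))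

theorem Sigma1.conjShift_apply (φ : Sigma1 d) (x ξ y : Rd d) :
    (φ.conjShift x ξ).toFun y = Complex.exp ((-2 * π * ⟪y, ξ⟫_ℝ : ℝ) * Complex.I) *
      starRingEnd ℂ (φ.toFun (y - x)) := by
  change starRingEnd ℂ (modulation ξ (_root_.translation x φ.toFun) y) = _
  simp only [modulation, _root_.translation, map_mul, ← Complex.exp_conj, Complex.conj_I,
    Complex.conj_ofReal, real_inner_comm ξ y, map_ofNat]
  congr 2
  push_cast
  ring

theorem Sigma1.norm_conjShift_apply (φ : Sigma1 d) (x ξ y : Rd d) :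
    ‖(φ.conjShift x ξ).toFun y‖ = ‖φ.toFun (y - x)‖ := by
  rw [φ.conjShift_apply, norm_mul, Complex.norm_exp_ofReal_mul_I, one_mul, RCLike.norm_conj]

theorem Sigma1.conjShift_zero_apply (φ : Sigma1 d) (x y : Rd d) :
    (φ.conjShift x 0).toFun y = starRingEnd ℂ (φ.toFun (y - x)) := by
  rw [φ.conjShift_apply, inner_zero_right, mul_zero, Complex.ofReal_zero, zero_mul,
    Complex.exp_zero, one_mul]

theorem integral_mul_conjShift (f : Rd d → ℂ) (φ : Sigma1 d) (x ξ : Rd d) :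
    ∫ y, f y * (φ.conjShift x ξ).toFun y =
      𝓕 (fun y => f y * starRingEnd ℂ (φ.toFun (y - x))) ξ := by
  rw [Real.fourier_eq']
  refine integral_congr_ae (Filter.Eventually.of_forall fun y => ?_)
  simp only [φ.conjShift_apply, smul_eq_mul]
  ring

theorem Sigma1.fourier_conjShift (φ : Sigma1 d) (x ξ : Rd d) :
    Sigma1.fourier d (φ.conjShift x ξ) =
      Complex.exp ((-2 * π * ⟪x, ξ⟫_ℝ : ℝ) * Complex.I) • φ.fourierInv.conjShift (-ξ) x := by
  refine Subtype.ext (funext fun η => ?_)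
  change 𝓕 (φ.conjShift x ξ).toFun η = Complex.exp _ * (φ.fourierInv.conjShift (-ξ) x).toFun η
  have hconj : starRingEnd ℂ (φ.fourierInv.toFun (η - -ξ)) =
      𝓕 (fun y => starRingEnd ℂ (φ.toFun y)) (η + ξ) := by
    rw [sub_neg_eq_add]
    exact conj_fourierInv _ _
  rw [φ.fourierInv.conjShift_apply, hconj, Real.fourier_eq', Real.fourier_eq',
    ← integral_add_right_eq_self _ x, ← mul_assoc, ← integral_const_mul]
  refine integral_congr_ae (Filter.Eventually.of_forall fun y => ?_)
  simp only [φ.conjShift_apply, add_sub_cancel_right, smul_eq_mul, ← mul_assoc,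
    ← Complex.exp_add]
  congr 2
  simp only [inner_add_left, inner_add_right, real_inner_comm η x]
  push_cast
  ring

theorem norm_stft_eq_norm_stft_fourier (φ : Sigma1 d) (u : Sigma1Dual d) (x ξ : Rd d) :
    ‖stft φ u x ξ‖ = ‖stft (Sigma1.fourier d φ) u.fourier ξ (-x)‖ := by
  change _ = ‖u (Sigma1.fourier d ((Sigma1.fourier d φ).conjShift ξ (-x)))‖
  rw [Sigma1.fourier_conjShift, Sigma1.fourierInv_fourier, neg_neg, map_smul, norm_smul,
    Complex.norm_exp_ofReal_mul_I, one_mul]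
  rfl

end TestFunctions

section Representation

variable {d : ℕ} {u : Sigma1Dual d}

theorem ae_eq_zero_of_forall_mul_translate_ae_eq_zero {G R : Type*} [AddCommGroup G]
    [TopologicalSpace G] [IsTopologicalAddGroup G] [SecondCountableTopology G]
    [MeasurableSpace G] {μ : Measure G} [MulZeroClass R] [NoZeroDivisors R] [TopologicalSpace R]
    [T1Space R] {f g : G → R} (hg : Continuous g) {y₀ : G} (hy₀ : g y₀ ≠ 0)
    (hfg : ∀ x, ∀ᵐ y ∂μ, f y * g (y - x) = 0) : f =ᵐ[μ] 0 := by
  refine measure_null_of_locally_null {y | ¬f y = 0} fun z _ => ?_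
  have hne : ∀ᶠ y in nhds z, g (y - (z - y₀)) ≠ 0 :=
    (hg.comp (continuous_id.sub continuous_const)).continuousAt.eventually_ne (by simpa using hy₀)
  refine ⟨_, Filter.inter_mem (nhdsWithin_le_nhds hne) self_mem_nhdsWithin,
    measure_mono_null ?_ (hfg (z - y₀))⟩
  rintro y ⟨hgy, hfy⟩ hy
  exact (mul_eq_zero.1 hy).elim hfy hgy

theorem Represents.integrable_mul_conj {f : Rd d → ℂ} (hf : Represents f u) (φ : Sigma1 d)
    (x : Rd d) : Integrable fun y => f y * starRingEnd ℂ (φ.toFun (y - x)) := by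
  simpa only [φ.conjShift_zero_apply] using (hf.2 (φ.conjShift x 0)).1

theorem Represents.stft_eq {f : Rd d → ℂ} (hf : Represents f u) (φ : Sigma1 d) (x ξ : Rd d) :
    stft φ u x ξ = 𝓕 (fun y => f y * starRingEnd ℂ (φ.toFun (y - x))) ξ := by
  rw [← integral_mul_conjShift]
  exact (hf.2 _).2

theorem Represents.sub {v : Sigma1Dual d} {f g : Rd d → ℂ} (hf : Represents f u)
    (hg : Represents g v) : Represents (f - g) (u - v) := by
  refine ⟨hf.1.sub hg.1, fun ψ => ?_⟩
  simp only [Pi.sub_apply, sub_mul]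
  refine ⟨(hf.2 ψ).1.sub (hg.2 ψ).1, ?_⟩
  rw [integral_sub (hf.2 ψ).1 (hg.2 ψ).1, ← (hf.2 ψ).2, ← (hg.2 ψ).2]
  rfl

theorem Represents.ae_eq_zero {φ : Sigma1 d} (hφ : φ ≠ 0) {f : Rd d → ℂ}
    (hf : Represents f 0) : f =ᵐ[volume] 0 := by
  obtain ⟨y₀, hy₀⟩ := φ.exists_ne_zero hφ
  have hmul (x : Rd d) : ∀ᵐ y, f y * starRingEnd ℂ (φ.toFun (y - x)) = 0 :=
    ae_eq_zero_of_fourier_eq_zero (hf.integrable_mul_conj φ x)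
      (funext fun ξ => (hf.stft_eq φ x ξ).symm)
  exact ae_eq_zero_of_forall_mul_translate_ae_eq_zero
    (Complex.continuous_conj.comp φ.continuous) ((map_ne_zero (starRingEnd ℂ)).2 hy₀) hmul

theorem Represents.ae_eq {φ : Sigma1 d} (hφ : φ ≠ 0) {f g : Rd d → ℂ} (hf : Represents f u)
    (hg : Represents g u) : f =ᵐ[volume] g := by
  have hfg : Represents (f - g) 0 := sub_self u ▸ hf.sub hg
  filter_upwards [hfg.ae_eq_zero hφ] with y hy using sub_eq_zero.1 hy

theorem Represents.congr_ae {f g : Rd d → ℂ} (hf : Represents f u) (hfg : f =ᵐ[volume] g) :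
    Represents g u := by
  refine ⟨(locallyIntegrable_congr hfg).1 hf.1, fun ψ => ?_⟩
  have hmul : (fun x => f x * ψ.toFun x) =ᵐ[volume] fun x => g x * ψ.toFun x := by
    filter_upwards [hfg] with x hx
    rw [hx]
  exact ⟨(hf.2 ψ).1.congr hmul, (hf.2 ψ).2.trans (integral_congr_ae hmul)⟩

theorem represents_of_norm_le {f : Rd d → ℂ} {C : ℝ} (hf : Continuous f)
    (hC : ∀ x, ‖f x‖ ≤ C) (h : ∀ ψ : Sigma1 d, u ψ = ∫ x, f x * ψ.toFun x) : Represents f u :=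
  ⟨hf.locallyIntegrable, fun ψ => ⟨ψ.integrable.bdd_mul hf.aestronglyMeasurable
    (Filter.Eventually.of_forall hC), h ψ⟩⟩

theorem Represents.fourier {f : Rd d → ℂ} (hf : Represents f u) (hfi : Integrable f) :
    Represents (𝓕 f) u.fourier :=
  represents_of_norm_le (continuous_fourier_of_integrable hfi) (norm_fourier_le_integral f)
    fun ψ => (hf.2 _).2.trans (integral_fourier_smul hfi ψ.integrable).symm

theorem Represents.fourierInv {f : Rd d → ℂ} (hf : Represents f u.fourier)
    (hfi : Integrable f) : Represents (𝓕⁻ f) u := by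
  refine represents_of_norm_le (C := ∫ x, ‖f x‖) (continuous_fourierInv_of_integrable hfi)
    (fun x => ?_) fun ψ => ?_
  · rw [Real.fourierInv_eq_fourier_neg]
    exact norm_fourier_le_integral f (-x)
  · calc u ψ = u.fourier ψ.fourierInv := congrArg u ψ.fourier_fourierInv.symm
      _ = ∫ x, f x * 𝓕⁻ ψ.toFun x := (hf.2 _).2
      _ = ∫ x, 𝓕⁻ f x * ψ.toFun x := (integral_fourierInv_smul hfi ψ.integrable).symm

end Representation

/-! ### Functions with integrable weighted Fourier data lie in the coorbit spaces -/

section Coorbit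

variable {d : ℕ} {s h : ℝ} {f : Rd d → ℂ} {u : Sigma1Dual d}

theorem lintegral_gevreyWeight_lt_top {E : Type*} [NormedAddCommGroup E] [NormedSpace ℝ E]
    [FiniteDimensional ℝ E] [MeasurableSpace E] [BorelSpace E] {μ : Measure E}
    [μ.IsAddHaarMeasure] {s h : ℝ} (hs : 1 ≤ s) (hh : 0 < h) :
    ∫⁻ x, ENNReal.ofReal (gevreyWeight s (-h) x) ∂μ < ⊤ :=
  (integrable_gevreyWeight hs hh).lintegral_lt_top

theorem GevreyIntegrable.exists_norm_stft_le (hs : 1 ≤ s) (hh : 0 < h)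
    (hf : GevreyIntegrable s h f) (hu : Represents f u) (φ : Sigma1 d) :
    ∃ C, ∀ x ξ, ‖stft φ u x ξ‖ ≤
      C * (gevreyWeight s (-(h / 2)) x * gevreyWeight s (-(h / 2)) ξ) := by
  obtain ⟨⟨A, hA⟩, ⟨B, hB⟩⟩ := φ.isSigma1.conj.2 h hh |>.imp
    (fun H => H.weightBound hs hh.le) (fun H => H.weightBound hs hh.le)
  obtain ⟨C, hC⟩ := hf.exists_norm_fourier_mul_translate_le hs hh.le φ.isSigma1.conj.integrable
    hA hB
  exact ⟨C, fun x ξ => hu.stft_eq φ x ξ ▸ hC x ξ⟩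

theorem GevreyIntegrable.mem_coorbit (hs : 1 ≤ s) (hh : 0 < h) (hf : GevreyIntegrable s h f)
    (hu : Represents f u) (φ : Sigma1 d) : u ∈ coorbit φ (h / 4) s := by
  obtain ⟨C, hC⟩ := hf.exists_norm_stft_le hs hh hu φ
  have hpoint (x ξ : Rd d) : ‖stft φ u x ξ‖ₑ ^ 2 ≤ ENNReal.ofReal (C ^ 2) *
      ENNReal.ofReal (gevreyWeight s (-h) ξ) * ENNReal.ofReal (gevreyWeight s (-h) x) := by
    rw [← ofReal_norm, ← ENNReal.ofReal_pow (norm_nonneg _), ← ENNReal.ofReal_mul (by positivity),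
      ← ENNReal.ofReal_mul (mul_nonneg (by positivity) (gevreyWeight_pos s _ _).le)]
    refine ENNReal.ofReal_le_ofReal ((pow_le_pow_left₀ (norm_nonneg _) (hC x ξ) 2).trans_eq ?_)
    rw [mul_pow, mul_pow, gevreyWeight_sq, gevreyWeight_sq]
    ring_nf
  have hinner (ξ : Rd d) : ∫⁻ x, ‖stft φ u x ξ‖ₑ ^ 2 ≤ ENNReal.ofReal (C ^ 2) *
      ENNReal.ofReal (gevreyWeight s (-h) ξ) *
        ∫⁻ x : Rd d, ENNReal.ofReal (gevreyWeight s (-h) x) :=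
    (lintegral_mono fun x => hpoint x ξ).trans_eq
      (lintegral_const_mul' _ _ (ENNReal.mul_ne_top ENNReal.ofReal_ne_top ENNReal.ofReal_ne_top))
  have hweight (ξ : Rd d) : ENNReal.ofReal (gevreyWeight s (-h) ξ) *
      ENNReal.ofReal (gevreyWeight s (2 * (h / 4)) ξ) =
        ENNReal.ofReal (gevreyWeight s (-(h / 2)) ξ) := by
    rw [← ENNReal.ofReal_mul (gevreyWeight_pos s _ _).le, ← gevreyWeight_add]
    ring_nf
  have htop := lintegral_gevreyWeight_lt_top (μ := (volume : Measure (Rd d))) hs hh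
  calc ∫⁻ ξ, (∫⁻ x, ‖stft φ u x ξ‖ₑ ^ 2) * ENNReal.ofReal (gevreyWeight s (2 * (h / 4)) ξ)
      ≤ ∫⁻ ξ, (ENNReal.ofReal (C ^ 2) * ∫⁻ x : Rd d, ENNReal.ofReal (gevreyWeight s (-h) x)) *
          ENNReal.ofReal (gevreyWeight s (-(h / 2)) ξ) := by
        refine lintegral_mono fun ξ => (mul_le_mul_left (hinner ξ) _).trans_eq ?_
        rw [← hweight]
        ring
    _ = (ENNReal.ofReal (C ^ 2) * ∫⁻ x : Rd d, ENNReal.ofReal (gevreyWeight s (-h) x)) *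
          ∫⁻ ξ : Rd d, ENNReal.ofReal (gevreyWeight s (-(h / 2)) ξ) :=
        lintegral_const_mul' _ _ (ENNReal.mul_ne_top ENNReal.ofReal_ne_top htop.ne)
    _ < ⊤ := ENNReal.mul_lt_top (ENNReal.mul_lt_top ENNReal.ofReal_lt_top htop)
        (lintegral_gevreyWeight_lt_top hs (half_pos hh))

theorem GevreyIntegrable.mem_coorbit_inter (hs : 1 ≤ s) (hh : 0 < h)
    (hf : GevreyIntegrable s h f) (hu : Represents f u) (φ : Sigma1 d) :
    u ∈ coorbit φ (h / 4) s ∩ fourierCoorbit φ (h / 4) s :=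
  have hs0 : 0 ≤ s := zero_le_one.trans hs
  ⟨hf.mem_coorbit hs hh hu φ, (hf.fourier hs0 hh.le).mem_coorbit hs hh
    (hu.fourier (hf.integrable hs0 hh.le)) φ⟩

end Coorbit

/-! ### Functionals on spaces mapped into a Banach space -/

section Functionals

theorem exists_continuousLinearMap_comp_eq {𝕜 V H : Type*} [RCLike 𝕜] [AddCommGroup V]
    [Module 𝕜 V] [NormedAddCommGroup H] [NormedSpace 𝕜 H] (J : V →ₗ[𝕜] H) (l : V →ₗ[𝕜] 𝕜) {C : ℝ}
    (h : ∀ v, ‖l v‖ ≤ C * ‖J v‖) : ∃ L : H →L[𝕜] 𝕜, ∀ v, L (J v) = l v := by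
  have hker : LinearMap.ker J ≤ LinearMap.ker l := fun v hv => by
    rw [LinearMap.mem_ker] at hv ⊢
    simpa [hv] using h v
  let l' : LinearMap.range J →ₗ[𝕜] 𝕜 :=
    (LinearMap.ker J).liftQ l hker ∘ₗ J.quotKerEquivRange.symm.toLinearMap
  have hl' (v : V) : l' ⟨J v, LinearMap.mem_range_self J v⟩ = l v := by
    simp only [l', LinearMap.comp_apply, LinearEquiv.coe_coe,
      LinearMap.quotKerEquivRange_symm_apply_image, Submodule.mkQ_apply, Submodule.liftQ_apply]
  have hbound : ∀ w, ‖l' w‖ ≤ C * ‖w‖ := by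
    rintro ⟨_, v, rfl⟩
    rw [hl']
    exact h v
  obtain ⟨L, hL, -⟩ := exists_extension_norm_eq (LinearMap.range J) (l'.mkContinuous C hbound)
  exact ⟨L, fun v => (hL ⟨J v, LinearMap.mem_range_self J v⟩).trans (hl' v)⟩

theorem exists_memLp_two_integral_eq {𝕜 X V : Type*} [RCLike 𝕜] [MeasurableSpace X]
    {μ : Measure X} [AddCommGroup V] [Module 𝕜 V] (J : V →ₗ[𝕜] Lp 𝕜 2 μ) (l : V →ₗ[𝕜] 𝕜) {C : ℝ}
    (h : ∀ v, ‖l v‖ ≤ C * ‖J v‖) :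
    ∃ g : X → 𝕜, MemLp g 2 μ ∧ ∀ v, l v = ∫ x, g x * J v x ∂μ := by
  obtain ⟨L, hL⟩ := exists_continuousLinearMap_comp_eq J l h
  set g₀ : Lp 𝕜 2 μ := (InnerProductSpace.toDual 𝕜 _).symm L
  refine ⟨fun x => starRingEnd 𝕜 (g₀ x), (Lp.memLp g₀).star, fun v => ?_⟩
  rw [← hL v, ← InnerProductSpace.toDual_symm_apply, L2.inner_def]
  simp only [RCLike.inner_apply']
  rfl

end Functionals

section BoundedContinuous

theorem continuous_of_norm_le_of_tendsto_cocompact {P X β : Type*} [TopologicalSpace P]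
    [TopologicalSpace X] [NormedAddCommGroup β] (G : P → X →ᵇ β)
    (hG : Continuous fun q : P × X => G q.1 q.2)
    (hdec : ∀ p₀, ∃ b : X → ℝ, Filter.Tendsto b (Filter.cocompact X) (nhds 0) ∧
      ∀ᶠ p in nhds p₀, ∀ x, ‖G p x‖ ≤ b x) : Continuous G := by
  refine continuous_iff_continuousAt.2 fun p₀ => ?_
  rw [ContinuousAt, BoundedContinuousFunction.tendsto_iff_tendstoUniformly,
    Metric.tendstoUniformly_iff]
  intro ε hε
  obtain ⟨b, hb, hGb⟩ := hdec p₀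
  obtain ⟨K, hK, hbK⟩ := Filter.mem_cocompact.1 (hb.eventually (gt_mem_nhds (half_pos hε)))
  let Gc : C(P, C(X, β)) := ContinuousMap.curry ⟨fun q : P × X => G q.1 q.2, hG⟩
  have hGK := Metric.tendstoUniformlyOn_iff.1
    (ContinuousMap.tendsto_iff_forall_isCompact_tendstoUniformlyOn.1
      (Gc.continuous.tendsto p₀) K hK) ε hε
  filter_upwards [hGK, hGb] with p hpK hpb x
  by_cases hx : x ∈ K
  · exact hpK x hx
  · have hbx : b x < ε / 2 := hbK hx
    calc dist (G p₀ x) (G p x) ≤ ‖G p₀ x‖ + ‖G p x‖ := dist_le_norm_add_norm _ _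
      _ < ε := by linarith [hpb x, hGb.self_of_nhds x]

end BoundedContinuous

/-! ### Test functions inside a Banach space -/

section Embedding

variable {d : ℕ} {h : ℝ}

/-- The isometric embedding of `Σ_1`, with the norm `sup_x |ψ(x)| e^{h |x|}`, into the Banach
space of bounded continuous functions. -/
def Sigma1.weighted (hh : 0 < h) : Sigma1 d →ₗ[ℂ] (Rd d →ᵇ ℂ) where
  toFun ψ := .ofNormedAddCommGroup (fun x => gevreyWeight 1 h x • ψ.toFun x)
    ((continuous_gevreyWeight zero_le_one h).smul ψ.continuous) (ψ.isSigma1.2 h hh).1.choose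
    fun x => by
      rw [norm_smul, norm_gevreyWeight, gevreyWeight_one, mul_comm]
      exact (ψ.isSigma1.2 h hh).1.choose_spec x
  map_add' ψ χ := by ext x; exact smul_add _ _ _
  map_smul' c ψ := by ext x; exact smul_comm _ c _

theorem Sigma1.norm_weighted_apply (hh : 0 < h) (ψ : Sigma1 d) (x : Rd d) :
    ‖Sigma1.weighted hh ψ x‖ = ‖ψ.toFun x‖ * gevreyWeight 1 h x := by
  change ‖gevreyWeight 1 h x • ψ.toFun x‖ = _
  rw [norm_smul, norm_gevreyWeight, mul_comm]

/-- The embedding of `Σ_1`, with one of its defining seminorms, into a Banach space. -/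
def Sigma1.embed (hh : 0 < h) : Sigma1 d →ₗ[ℂ] (Rd d →ᵇ ℂ) × (Rd d →ᵇ ℂ) :=
  (Sigma1.weighted hh).prod (Sigma1.weighted hh ∘ₗ (Sigma1.fourier d).toLinearMap)

theorem sigma1Seminorm_le_norm_embed (hh : 0 < h) {k : Set.Ioi (0 : ℝ)} (hk : k ≤ h)
    (ψ : Sigma1 d) : sigma1Seminorm d k ψ ≤ 2 * ‖Sigma1.embed hh ψ‖ := by
  have hmono (χ : Sigma1 d) : expSup k χ.toFun ≤ ‖Sigma1.weighted hh χ‖ := by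
    refine ciSup_le fun x => ?_
    rw [← gevreyWeight_one]
    calc ‖χ.toFun x‖ * gevreyWeight 1 k x ≤ ‖χ.toFun x‖ * gevreyWeight 1 h x := by
          gcongr; exact gevreyWeight_mono hk x
      _ = ‖Sigma1.weighted hh χ x‖ := (χ.norm_weighted_apply hh x).symm
      _ ≤ ‖Sigma1.weighted hh χ‖ := BoundedContinuousFunction.norm_coe_le_norm _ x
  calc sigma1Seminorm d k ψ = expSup k ψ.toFun + expSup k (Sigma1.fourier d ψ).toFun := rfl
    _ ≤ ‖(Sigma1.embed hh ψ).1‖ + ‖(Sigma1.embed hh ψ).2‖ := add_le_add (hmono _) (hmono _)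
    _ ≤ 2 * ‖Sigma1.embed hh ψ‖ := by
        rw [two_mul]
        exact add_le_add (norm_fst_le _) (norm_snd_le _)

theorem Sigma1Dual.exists_continuousLinearMap (u : Sigma1Dual d) :
    ∃ (h : ℝ) (hh : 0 < h) (L : (Rd d →ᵇ ℂ) × (Rd d →ᵇ ℂ) →L[ℂ] ℂ),
      ∀ ψ, L (Sigma1.embed hh ψ) = u ψ := by
  obtain ⟨S, C, -, hC⟩ := Seminorm.bound_of_continuous (sigma1_withSeminorms d)
    ((normSeminorm ℂ ℂ).comp u.toLinearMap) (continuous_norm.comp u.continuous)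
  obtain ⟨h, hh, hS⟩ : ∃ h : ℝ, 0 < h ∧ ∀ k ∈ S, (k : ℝ) ≤ h := by
    obtain ⟨M, hM⟩ := (S.finite_toSet.image ((↑) : Set.Ioi (0 : ℝ) → ℝ)).bddAbove
    exact ⟨max M 1, by positivity, fun k hk => (hM ⟨k, hk, rfl⟩).trans (le_max_left M 1)⟩
  refine ⟨h, hh, exists_continuousLinearMap_comp_eq (C := C * 2) _ u.toLinearMap fun ψ => ?_⟩
  calc ‖u ψ‖ ≤ C * (S.sup (sigma1Seminorm d)) ψ := hC ψ
    _ ≤ C * (2 * ‖Sigma1.embed hh ψ‖) := by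
        gcongr
        exact Seminorm.finset_sup_apply_le (by positivity) fun k hk =>
          sigma1Seminorm_le_norm_embed hh (hS k hk) ψ
    _ = C * 2 * ‖Sigma1.embed hh ψ‖ := (mul_assoc _ _ _).symm

theorem Sigma1.exists_norm_weighted_conjShift_apply_le (hh : 0 < h) (φ : Sigma1 d) :
    ∃ C, 0 ≤ C ∧ ∀ x ξ y, ‖Sigma1.weighted hh (φ.conjShift x ξ) y‖ ≤
      C * gevreyWeight 1 (h + 1) x * gevreyWeight 1 (-1) y := by
  obtain ⟨C, hC⟩ := (φ.isSigma1.2 (h + 1) (by positivity)).1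
  refine ⟨C, le_trans (by positivity) (hC 0), fun x ξ y => ?_⟩
  have hsub : gevreyWeight 1 (h + 1) y ≤
      gevreyWeight 1 (h + 1) (y - x) * gevreyWeight 1 (h + 1) x := by
    simpa [gevreyWeight_neg] using
      gevreyWeight_le_mul_sub le_rfl (by positivity : 0 ≤ h + 1) y (y - x)
  have hy := gevreyWeight_pos 1 (-1) y
  have hx := gevreyWeight_pos 1 (h + 1) x
  calc ‖Sigma1.weighted hh (φ.conjShift x ξ) y‖
      = ‖φ.toFun (y - x)‖ * (gevreyWeight 1 (h + 1) y * gevreyWeight 1 (-1) y) := by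
        rw [Sigma1.norm_weighted_apply, Sigma1.norm_conjShift_apply, ← gevreyWeight_add]
        ring_nf
    _ ≤ ‖φ.toFun (y - x)‖ *
          (gevreyWeight 1 (h + 1) (y - x) * gevreyWeight 1 (h + 1) x * gevreyWeight 1 (-1) y) := by
        gcongr
    _ = ‖φ.toFun (y - x)‖ * gevreyWeight 1 (h + 1) (y - x) * gevreyWeight 1 (h + 1) x *
          gevreyWeight 1 (-1) y := by ring
    _ ≤ C * gevreyWeight 1 (h + 1) x * gevreyWeight 1 (-1) y := by
        gcongr
        rw [gevreyWeight_one]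
        exact hC _

theorem Sigma1.exists_norm_weighted_conjShift_le (hh : 0 < h) (φ : Sigma1 d) :
    ∃ C, 0 ≤ C ∧ ∀ x ξ, ‖Sigma1.weighted hh (φ.conjShift x ξ)‖ ≤
      C * gevreyWeight 1 (h + 1) x := by
  obtain ⟨C, hC0, hC⟩ := φ.exists_norm_weighted_conjShift_apply_le hh
  have hpos (x : Rd d) := gevreyWeight_pos 1 (h + 1) x
  refine ⟨C, hC0, fun x ξ => (BoundedContinuousFunction.norm_le (mul_nonneg hC0 (hpos x).le)).2
    fun y => (hC x ξ y).trans (mul_le_of_le_one_right (mul_nonneg hC0 (hpos x).le) ?_)⟩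
  rw [gevreyWeight_one, Real.exp_le_one_iff]
  linarith [norm_nonneg y]

theorem Sigma1.exists_norm_embed_conjShift_le (hh : 0 < h) (φ : Sigma1 d) :
    ∃ C, ∀ x ξ, ‖Sigma1.embed hh (φ.conjShift x ξ)‖ ≤
      C * (gevreyWeight 1 (h + 1) x * gevreyWeight 1 (h + 1) ξ) := by
  obtain ⟨A, hA0, hA⟩ := φ.exists_norm_weighted_conjShift_le hh
  obtain ⟨B, -, hB⟩ := φ.fourierInv.exists_norm_weighted_conjShift_le hh
  have hone (x : Rd d) : 1 ≤ gevreyWeight 1 (h + 1) x := Real.one_le_exp (by positivity)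
  have hpos (x : Rd d) : 0 < gevreyWeight 1 (h + 1) x := gevreyWeight_pos _ _ _
  have hfst (x ξ : Rd d) : A * gevreyWeight 1 (h + 1) x ≤
      max A B * (gevreyWeight 1 (h + 1) x * gevreyWeight 1 (h + 1) ξ) :=
    mul_le_mul (le_max_left A B) (le_mul_of_one_le_right (hpos x).le (hone ξ)) (hpos x).le
      (le_max_of_le_left hA0)
  have hsnd (x ξ : Rd d) : B * gevreyWeight 1 (h + 1) ξ ≤
      max A B * (gevreyWeight 1 (h + 1) x * gevreyWeight 1 (h + 1) ξ) :=
    mul_le_mul (le_max_right A B) (le_mul_of_one_le_left (hpos ξ).le (hone x)) (hpos ξ).le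
      (le_max_of_le_left hA0)
  refine ⟨max A B, fun x ξ => max_le ((hA x ξ).trans (hfst x ξ)) ?_⟩
  calc ‖Sigma1.weighted hh (Sigma1.fourier d (φ.conjShift x ξ))‖
      = ‖Sigma1.weighted hh (φ.fourierInv.conjShift (-ξ) x)‖ := by
        rw [φ.fourier_conjShift, map_smul, norm_smul, Complex.norm_exp_ofReal_mul_I, one_mul]
    _ ≤ B * gevreyWeight 1 (h + 1) ξ := gevreyWeight_neg 1 (h + 1) ξ ▸ hB (-ξ) x
    _ ≤ _ := hsnd x ξ

theorem Sigma1.continuous_weighted_conjShift (hh : 0 < h) (φ : Sigma1 d) :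
    Continuous fun p : Rd d × Rd d => Sigma1.weighted hh (φ.conjShift p.1 p.2) := by
  obtain ⟨C, hC0, hC⟩ := φ.exists_norm_weighted_conjShift_apply_le hh
  have hw := continuous_gevreyWeight (E := Rd d) (zero_le_one' ℝ)
  have hφ := φ.continuous
  refine continuous_of_norm_le_of_tendsto_cocompact _ ?_ fun p₀ => ?_
  · change Continuous fun q : (Rd d × Rd d) × Rd d =>
      gevreyWeight 1 h q.2 • (φ.conjShift q.1.1 q.1.2).toFun q.2
    simp only [φ.conjShift_apply]
    exact ((hw h).comp continuous_snd).smul (by fun_prop)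
  · have hnear : ∀ᶠ p in nhds p₀,
        gevreyWeight 1 (h + 1) p.1 < gevreyWeight 1 (h + 1) p₀.1 + 1 :=
      ((hw _).comp continuous_fst).continuousAt.eventually (gt_mem_nhds (lt_add_one _))
    refine ⟨fun y => C * (gevreyWeight 1 (h + 1) p₀.1 + 1) * gevreyWeight 1 (-1) y, ?_, ?_⟩
    · simpa only [mul_zero] using
        (tendsto_gevreyWeight_cocompact one_pos one_pos).const_mul _
    · filter_upwards [hnear] with p hp y
      have := gevreyWeight_pos 1 (-1) y
      exact (hC p.1 p.2 y).trans (by gcongr)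

theorem Sigma1.continuous_embed_conjShift (hh : 0 < h) (φ : Sigma1 d) :
    Continuous fun p : Rd d × Rd d => Sigma1.embed hh (φ.conjShift p.1 p.2) := by
  have hphase : Continuous fun p : Rd d × Rd d =>
      Complex.exp ((-2 * π * ⟪p.1, p.2⟫_ℝ : ℝ) * Complex.I) := by fun_prop
  have hswap : Continuous fun p : Rd d × Rd d => (-p.2, p.1) := by fun_prop
  have hsnd := (φ.fourierInv.continuous_weighted_conjShift hh).comp hswap
  refine (φ.continuous_weighted_conjShift hh).prodMk ((hphase.smul hsnd).congr fun p => ?_)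
  simp only [Pi.smul_apply', Function.comp_apply, LinearMap.comp_apply,
    ContinuousLinearMap.coe_coe, φ.fourier_conjShift, map_smul]

theorem continuous_stft (φ : Sigma1 d) (u : Sigma1Dual d) :
    Continuous fun p : Rd d × Rd d => stft φ u p.1 p.2 := by
  obtain ⟨h, hh, L, hL⟩ := u.exists_continuousLinearMap
  simp only [stft, ← hL]
  exact L.continuous.comp (φ.continuous_embed_conjShift hh)

end Embedding

/-! ### Inversion of the short-time Fourier transform -/

section Inversion

variable {d : ℕ} {h : ℝ}

theorem Sigma1.exists_norm_le (φ : Sigma1 d) : ∃ C, ∀ x, ‖φ.toFun x‖ ≤ C := by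
  obtain ⟨C, hC⟩ := (φ.isSigma1.2 1 one_pos).1
  exact ⟨C, fun x => (le_mul_of_one_le_right (norm_nonneg _)
    (Real.one_le_exp (by positivity))).trans (hC x)⟩

/-- The coefficients `⟨χ, M_{-ξ} T_x (conj φ)⟩` with which a test function `χ` is synthesised from
the functions `conj (M_ξ T_x φ)`. -/
def synthesisCoeff (φ χ : Sigma1 d) (x ξ : Rd d) : ℂ :=
  𝓕⁻ (fun y => χ.toFun y * φ.toFun (y - x)) ξ

theorem integrable_mul_translate (φ χ : Sigma1 d) (x : Rd d) :
    Integrable fun y => χ.toFun y * φ.toFun (y - x) := by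
  obtain ⟨C, hC⟩ := φ.exists_norm_le
  exact χ.integrable.mul_bdd (φ.continuous.comp (continuous_sub_right x)).aestronglyMeasurable
    (.of_forall fun y => hC (y - x))

theorem exists_norm_synthesisCoeff_le (hh : 0 < h) (φ χ : Sigma1 d) :
    ∃ C, ∀ x ξ, ‖synthesisCoeff φ χ x ξ‖ ≤ C * (gevreyWeight 1 (-h) x * gevreyWeight 1 (-h) ξ) := by
  have hh' : 0 < 2 * h := by positivity
  obtain ⟨A, hA⟩ := (φ.isSigma1.2 (2 * h) hh').1.weightBound le_rfl hh'.le
  obtain ⟨B, hB⟩ := (φ.isSigma1.2 (2 * h) hh').2.weightBound le_rfl hh'.le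
  obtain ⟨C, hC⟩ := (χ.gevreyIntegrable le_rfl hh'.le).exists_norm_fourier_mul_translate_le
    le_rfl hh'.le φ.integrable hA hB
  refine ⟨C, fun x ξ => ?_⟩
  simpa only [synthesisCoeff, Real.fourierInv_eq_fourier_neg, gevreyWeight_neg,
    mul_div_cancel_left₀ h two_ne_zero] using hC x (-ξ)

theorem continuous_synthesisCoeff (φ χ : Sigma1 d) :
    Continuous fun p : Rd d × Rd d => synthesisCoeff φ χ p.1 p.2 := by
  obtain ⟨C, hC⟩ := φ.exists_norm_le
  have hφ := φ.continuous
  have hχ := χ.continuous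
  simp only [synthesisCoeff, Real.fourierInv_eq']
  refine continuous_of_dominated (bound := fun y => ‖χ.toFun y‖ * C)
    (fun p => Continuous.aestronglyMeasurable (by fun_prop))
    (fun p => .of_forall fun y => ?_) (χ.integrable.norm.mul_const C)
    (.of_forall fun y => by fun_prop)
  rw [norm_smul, Complex.norm_exp_ofReal_mul_I, one_mul, norm_mul]
  gcongr
  exact hC _

theorem integrable_of_norm_le_gevreyWeight_mul {E : Type*} [NormedAddCommGroup E]
    {F : Rd d × Rd d → E} {C : ℝ} (hF : Continuous F)
    (hC : ∀ p, ‖F p‖ ≤ C * (gevreyWeight 1 (-1) p.1 * gevreyWeight 1 (-1) p.2)) : Integrable F :=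
  (((integrable_gevreyWeight le_rfl one_pos).mul_prod
    (integrable_gevreyWeight le_rfl one_pos)).const_mul C).mono' hF.aestronglyMeasurable
    (.of_forall hC)

theorem integrable_synthesisCoeff (φ χ : Sigma1 d) (x : Rd d) :
    Integrable (synthesisCoeff φ χ x) := by
  obtain ⟨C, hC⟩ := exists_norm_synthesisCoeff_le one_pos φ χ
  refine (((integrable_gevreyWeight le_rfl one_pos).const_mul (gevreyWeight 1 (-1) x)).const_mul
    C).mono' ?_ (.of_forall fun ξ => hC x ξ)
  exact ((continuous_synthesisCoeff φ χ).comp (.prodMk_right x)).aestronglyMeasurable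

theorem fourier_synthesisCoeff (φ χ : Sigma1 d) (x : Rd d) :
    𝓕 (synthesisCoeff φ χ x) = fun y => χ.toFun y * φ.toFun (y - x) := by
  have hcont : Continuous fun y => χ.toFun y * φ.toFun (y - x) :=
    χ.continuous.mul (φ.continuous.comp (continuous_sub_right x))
  refine hcont.fourier_fourierInv_eq (integrable_mul_translate φ χ x) ?_
  have := (integrable_synthesisCoeff φ χ x).comp_neg
  simpa only [synthesisCoeff, Real.fourierInv_eq_fourier_neg, neg_neg] using this

theorem integral_synthesisCoeff_mul_conjShift (φ χ : Sigma1 d) (y : Rd d) :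
    ∫ p : Rd d × Rd d, synthesisCoeff φ χ p.1 p.2 * (φ.conjShift p.1 p.2).toFun y =
      ((∫ x, ‖φ.toFun x‖ ^ 2 : ℝ) : ℂ) * χ.toFun y := by
  have hinner (x : Rd d) : ∫ ξ, synthesisCoeff φ χ x ξ * (φ.conjShift x ξ).toFun y =
      φ.toFun (y - x) * starRingEnd ℂ (φ.toFun (y - x)) * χ.toFun y :=
    calc ∫ ξ, synthesisCoeff φ χ x ξ * (φ.conjShift x ξ).toFun y
        = 𝓕 (synthesisCoeff φ χ x) y * starRingEnd ℂ (φ.toFun (y - x)) := by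
          rw [Real.fourier_eq', ← integral_mul_const]
          congr 1 with ξ
          rw [φ.conjShift_apply, smul_eq_mul, real_inner_comm]
          ring
      _ = _ := by rw [fourier_synthesisCoeff]; ring
  have hint : Integrable fun p : Rd d × Rd d =>
      synthesisCoeff φ χ p.1 p.2 * (φ.conjShift p.1 p.2).toFun y := by
    obtain ⟨C, hC⟩ := exists_norm_synthesisCoeff_le one_pos φ χ
    obtain ⟨D, hD⟩ := φ.exists_norm_le
    have hφ := φ.continuous
    refine Integrable.mul_bdd (c := D) ?_ ?_ ?_
    · exact integrable_of_norm_le_gevreyWeight_mul (continuous_synthesisCoeff φ χ)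
        fun p => hC p.1 p.2
    · simp only [φ.conjShift_apply]
      exact Continuous.aestronglyMeasurable (by fun_prop)
    · exact .of_forall fun p => (φ.norm_conjShift_apply p.1 p.2 y).trans_le (hD _)
  rw [Measure.volume_eq_prod, integral_prod _ hint]
  simp only [hinner]
  rw [integral_mul_const, integral_sub_left_eq_self
    (fun x => φ.toFun x * starRingEnd ℂ (φ.toFun x)) volume y, integral_mul_conj_self]

section Integral

variable {P : Type*} [MeasurableSpace P] {ν : Measure P} {c : P → ℂ} {Ψ : P → Sigma1 d}
  {χ : Sigma1 d}

theorem Sigma1.integral_smul_weighted (hh : 0 < h)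
    (hi : Integrable (fun p => c p • Sigma1.weighted hh (Ψ p)) ν)
    (hχ : ∀ y, ∫ p, c p * (Ψ p).toFun y ∂ν = χ.toFun y) :
    ∫ p, c p • Sigma1.weighted hh (Ψ p) ∂ν = Sigma1.weighted hh χ := by
  ext y
  calc (∫ p, c p • Sigma1.weighted hh (Ψ p) ∂ν) y
      = ∫ p, gevreyWeight 1 h y • (c p * (Ψ p).toFun y) ∂ν := by
        rw [← BoundedContinuousFunction.evalCLM_apply ℂ,
          ← (BoundedContinuousFunction.evalCLM ℂ y).integral_comp_comm hi]
        exact integral_congr_ae (.of_forall fun p => smul_comm (c p) (gevreyWeight 1 h y) _)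
    _ = gevreyWeight 1 h y • χ.toFun y := by rw [integral_smul, hχ]

theorem Sigma1.integral_smul_embed [SFinite ν] (hh : 0 < h)
    (hm : AEStronglyMeasurable (fun q : P × Rd d => c q.1 * (Ψ q.1).toFun q.2) (ν.prod volume))
    (hi : Integrable (fun p => c p • Sigma1.embed hh (Ψ p)) ν)
    (hχ : ∀ y, ∫ p, c p * (Ψ p).toFun y ∂ν = χ.toFun y) :
    ∫ p, c p • Sigma1.embed hh (Ψ p) ∂ν = Sigma1.embed hh χ := by
  have hbound (p : P) (y : Rd d) : ‖c p * (Ψ p).toFun y‖ ≤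
      ‖c p • Sigma1.embed hh (Ψ p)‖ * gevreyWeight 1 (-h) y := by
    have hw := gevreyWeight_pos 1 h y
    rw [gevreyWeight_neg_rate, ← div_eq_mul_inv, le_div_iff₀ hw, norm_mul, norm_smul, mul_assoc,
      ← Sigma1.norm_weighted_apply hh]
    gcongr
    exact ((Sigma1.weighted hh (Ψ p)).norm_coe_le_norm y).trans (le_max_left _ _)
  have hjoint : Integrable (Function.uncurry fun p y => c p * (Ψ p).toFun y) (ν.prod volume) :=
    (hi.norm.mul_prod (integrable_gevreyWeight le_rfl hh)).mono' hm
      (.of_forall fun q => hbound q.1 q.2)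
  have hfourier (η : Rd d) : ∫ p, c p * (Sigma1.fourier d (Ψ p)).toFun η ∂ν =
      (Sigma1.fourier d χ).toFun η :=
    calc ∫ p, c p * 𝓕 (Ψ p).toFun η ∂ν = ∫ p, 𝓕 (fun y => c p * (Ψ p).toFun y) η ∂ν :=
          integral_congr_ae (.of_forall fun p => (congrFun (fourier_const_smul' _ _) η).symm)
      _ = 𝓕 χ.toFun η := by rw [← fourier_integral hjoint, funext hχ]
  refine Prod.ext ?_ ?_
  · exact (fst_integral hi).trans (Sigma1.integral_smul_weighted hh hi.fst hχ)
  · exact (snd_integral hi).trans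
      (Sigma1.integral_smul_weighted (Ψ := fun p => Sigma1.fourier d (Ψ p)) hh hi.snd hfourier)

end Integral

theorem integrable_synthesisCoeff_smul_embed (hh : 0 < h) (φ χ : Sigma1 d) :
    Integrable fun p : Rd d × Rd d =>
      synthesisCoeff φ χ p.1 p.2 • Sigma1.embed hh (φ.conjShift p.1 p.2) := by
  obtain ⟨C, hC⟩ := exists_norm_synthesisCoeff_le (h := h + 2) (by positivity) φ χ
  obtain ⟨D, hD⟩ := φ.exists_norm_embed_conjShift_le hh
  have hweight (z : Rd d) :
      gevreyWeight 1 (-(h + 2)) z * gevreyWeight 1 (h + 1) z = gevreyWeight 1 (-1) z := by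
    rw [← gevreyWeight_add]
    ring_nf
  refine integrable_of_norm_le_gevreyWeight_mul (C := C * D)
    ((continuous_synthesisCoeff φ χ).smul (φ.continuous_embed_conjShift hh)) fun p => ?_
  rw [norm_smul]
  refine (mul_le_mul (hC p.1 p.2) (hD p.1 p.2) (norm_nonneg _)
    ((norm_nonneg _).trans (hC p.1 p.2))).trans_eq ?_
  rw [← hweight, ← hweight]
  ring

theorem integral_synthesisCoeff_mul_stft (φ χ : Sigma1 d) (u : Sigma1Dual d) :
    ∫ p : Rd d × Rd d, synthesisCoeff φ χ p.1 p.2 * stft φ u p.1 p.2 =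
      ((∫ x, ‖φ.toFun x‖ ^ 2 : ℝ) : ℂ) * u χ := by
  obtain ⟨h, hh, L, hL⟩ := u.exists_continuousLinearMap
  have hint := integrable_synthesisCoeff_smul_embed hh φ χ
  have hcoeff := continuous_synthesisCoeff φ χ
  have hφ := φ.continuous
  have hmeas : Continuous fun q : (Rd d × Rd d) × Rd d =>
      synthesisCoeff φ χ q.1.1 q.1.2 * (φ.conjShift q.1.1 q.1.2).toFun q.2 := by
    simp only [φ.conjShift_apply]
    exact (hcoeff.comp continuous_fst).mul (by fun_prop)
  calc ∫ p : Rd d × Rd d, synthesisCoeff φ χ p.1 p.2 * stft φ u p.1 p.2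
      = L (∫ p : Rd d × Rd d,
          synthesisCoeff φ χ p.1 p.2 • Sigma1.embed hh (φ.conjShift p.1 p.2)) := by
        rw [← L.integral_comp_comm hint]
        simp only [map_smul, hL, smul_eq_mul, stft]
    _ = L (Sigma1.embed hh (((∫ x, ‖φ.toFun x‖ ^ 2 : ℝ) : ℂ) • χ)) := by
        rw [Sigma1.integral_smul_embed (χ := ((∫ x, ‖φ.toFun x‖ ^ 2 : ℝ) : ℂ) • χ) hh
          hmeas.aestronglyMeasurable hint (integral_synthesisCoeff_mul_conjShift φ χ)]
    _ = ((∫ x, ‖φ.toFun x‖ ^ 2 : ℝ) : ℂ) * u χ := by rw [hL, map_smul, smul_eq_mul]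

end Inversion

/-! ### Weighted square integrable short-time Fourier transforms -/

section WeightedSquare

variable {V : Type*} [NormedAddCommGroup V] {s h : ℝ}

theorem enorm_gevreyWeight_neg_smul_mul_translate_le (hs : 1 ≤ s) (hh : 0 ≤ h) (f g : V → ℂ)
    (x y : V) : ‖gevreyWeight s (-h) x • (f y * g (y - x))‖ₑ ≤
      ‖gevreyWeight s (-h) y • f y‖ₑ * ‖gevreyWeight s h (y - x) • g (y - x)‖ₑ := by
  have hx := gevreyWeight_pos s h x
  have hy := gevreyWeight_pos s h y
  have hweight : gevreyWeight s (-h) x ≤ gevreyWeight s (-h) y * gevreyWeight s h (y - x) := by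
    rw [gevreyWeight_neg_rate, gevreyWeight_neg_rate, inv_mul_eq_div, le_div_iff₀ hy,
      inv_mul_le_iff₀ hx, ← gevreyWeight_neg s h (y - x), neg_sub]
    exact gevreyWeight_le_mul_sub hs hh y x
  rw [← enorm_mul, enorm_le_iff_norm_le]
  simp only [norm_smul, norm_mul, norm_gevreyWeight]
  calc gevreyWeight s (-h) x * (‖f y‖ * ‖g (y - x)‖)
      ≤ gevreyWeight s (-h) y * gevreyWeight s h (y - x) * (‖f y‖ * ‖g (y - x)‖) := by gcongr
    _ = gevreyWeight s (-h) y * ‖f y‖ * (gevreyWeight s h (y - x) * ‖g (y - x)‖) := by ring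

theorem lintegral_enorm_sq_gevreyWeight_neg_smul_mul_translate_le [MeasurableSpace V]
    [BorelSpace V] [SecondCountableTopology V] {μ : Measure V} [SFinite μ] [μ.IsAddLeftInvariant]
    [μ.IsNegInvariant] (hs : 1 ≤ s) (hh : 0 ≤ h) {f g : V → ℂ}
    (hf : Measurable f) (hg : Measurable g) :
    ∫⁻ x, ∫⁻ y, ‖gevreyWeight s (-h) x • (f y * g (y - x))‖ₑ ^ 2 ∂μ ∂μ ≤
      (∫⁻ y, ‖gevreyWeight s (-h) y • f y‖ₑ ^ 2 ∂μ) *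
        ∫⁻ y, ‖gevreyWeight s h y • g y‖ₑ ^ 2 ∂μ := by
  have hw (k : ℝ) : Measurable fun x : V => gevreyWeight s k x :=
    (continuous_gevreyWeight (by positivity) k).measurable
  have hwh := hw (-h)
  calc ∫⁻ x, ∫⁻ y, ‖gevreyWeight s (-h) x • (f y * g (y - x))‖ₑ ^ 2 ∂μ ∂μ
      = ∫⁻ y, ∫⁻ x, ‖gevreyWeight s (-h) x • (f y * g (y - x))‖ₑ ^ 2 ∂μ ∂μ :=
        lintegral_lintegral_swap (Measurable.aemeasurable (by
          simp only [Function.uncurry_def]; fun_prop))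
    _ ≤ ∫⁻ y, ∫⁻ x, ‖gevreyWeight s (-h) y • f y‖ₑ ^ 2 *
          ‖gevreyWeight s h (y - x) • g (y - x)‖ₑ ^ 2 ∂μ ∂μ := by
        gcongr with y x
        rw [← mul_pow]
        gcongr
        exact enorm_gevreyWeight_neg_smul_mul_translate_le hs hh f g x y
    _ = ∫⁻ y, ‖gevreyWeight s (-h) y • f y‖ₑ ^ 2 *
          ∫⁻ x, ‖gevreyWeight s h x • g x‖ₑ ^ 2 ∂μ ∂μ := by
        congr 1 with y
        rw [lintegral_const_mul' _ _ (ENNReal.pow_ne_top enorm_ne_top),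
          lintegral_sub_left_eq_self (fun t => ‖gevreyWeight s h t • g t‖ₑ ^ 2) y]
    _ = _ := lintegral_mul_const _ (((hw _).smul hf).enorm.pow_const 2)

end WeightedSquare

section Representation

variable {d : ℕ} {s h : ℝ} {φ : Sigma1 d} {u : Sigma1Dual d}

theorem Sigma1.integral_norm_sq_pos (hφ : φ ≠ 0) : 0 < ∫ x, ‖φ.toFun x‖ ^ 2 := by
  obtain ⟨y, hy⟩ := φ.exists_ne_zero hφ
  obtain ⟨C, hC⟩ := φ.exists_norm_le
  have hint : Integrable fun x => ‖φ.toFun x‖ ^ 2 := by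
    simp only [sq]
    exact φ.integrable.norm.mul_bdd φ.continuous.norm.aestronglyMeasurable
      (.of_forall fun x => (norm_norm _).trans_le (hC x))
  exact integral_pos_of_integrable_nonneg_nonzero (φ.continuous.norm.pow 2) hint
    (fun x => by positivity) (pow_ne_zero 2 (norm_ne_zero_iff.2 hy))

theorem Sigma1.memLp_two_gevreyWeight_smul (hs : 1 ≤ s) (k : ℝ) (χ : Sigma1 d) :
    MemLp (fun x => gevreyWeight s k x • χ.toFun x) 2 := by
  have hk : 0 < |k| + 1 := by positivity
  obtain ⟨C, hC⟩ := (χ.isSigma1.2 (|k| + 1) hk).1.weightBound hs hk.le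
  have hlt : 0 < |k| + 1 - k := by linarith [le_abs_self k]
  refine ((memLp_two_gevreyWeight hs hlt).const_mul C).of_le
    ((continuous_gevreyWeight (by positivity) k).smul χ.continuous).aestronglyMeasurable
    (.of_forall fun x => ?_)
  exact (norm_gevreyWeight_smul_le k (hC x)).trans (le_abs_self _)

/-- The map `χ ↦ e^{k |x|^{1/s}} χ` from `Σ_1` to `L²`. -/
def Sigma1.weightedL2 (hs : 1 ≤ s) (k : ℝ) : Sigma1 d →ₗ[ℂ] Lp ℂ 2 (volume : Measure (Rd d)) where
  toFun χ := (χ.memLp_two_gevreyWeight_smul hs k).toLp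
  map_add' χ ψ := by
    rw [← MemLp.toLp_add]
    exact MemLp.toLp_congr _ _ (.of_forall fun x => smul_add _ _ _)
  map_smul' c χ := by
    rw [RingHom.id_apply, ← MemLp.toLp_const_smul]
    exact MemLp.toLp_congr _ _ (.of_forall fun x => smul_comm _ c _)

theorem eLpNorm_two_sq {X E : Type*} [MeasurableSpace X] [NormedAddCommGroup E] {μ : Measure X}
    (f : X → E) : eLpNorm f 2 μ ^ 2 = ∫⁻ x, ‖f x‖ₑ ^ 2 ∂μ := by
  simpa using eLpNorm_nnreal_pow_eq_lintegral (f := f) (μ := μ) (p := 2) two_ne_zero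

theorem memLp_two_of_lintegral_enorm_sq_lt_top {X E : Type*} [MeasurableSpace X]
    [NormedAddCommGroup E] {μ : Measure X} {f : X → E} (hf : AEStronglyMeasurable f μ)
    (hlt : ∫⁻ x, ‖f x‖ₑ ^ 2 ∂μ < ⊤) : MemLp f 2 μ :=
  ⟨hf, (ENNReal.pow_lt_top_iff.1 (eLpNorm_two_sq f ▸ hlt)).resolve_right two_ne_zero⟩

theorem lintegral_enorm_mul_le_eLpNorm_mul_eLpNorm {X : Type*} [MeasurableSpace X]
    {μ : Measure X} {f g : X → ℂ} (hf : AEStronglyMeasurable f μ) (hg : AEStronglyMeasurable g μ) :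
    ∫⁻ x, ‖f x * g x‖ₑ ∂μ ≤ eLpNorm f 2 μ * eLpNorm g 2 μ := by
  rw [← eLpNorm_one_eq_lintegral_enorm]
  exact eLpNorm_smul_le_mul_eLpNorm (φ := f) hg hf

theorem lintegral_enorm_sq_synthesisCoeff (φ χ : Sigma1 d) (x : Rd d) :
    ∫⁻ ξ, ‖synthesisCoeff φ χ x ξ‖ₑ ^ 2 = ∫⁻ y, ‖χ.toFun y * φ.toFun (y - x)‖ₑ ^ 2 := by
  have hcoeff := fourier_synthesisCoeff φ χ x
  rw [← lintegral_enorm_sq_fourier (integrable_synthesisCoeff φ χ x)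
    (hcoeff ▸ integrable_mul_translate φ χ x), hcoeff]

theorem eLpNorm_gevreyWeight_neg_smul_synthesisCoeff_le (hs : 1 ≤ s) (hh : 0 ≤ h)
    (φ χ : Sigma1 d) :
    eLpNorm (fun p : Rd d × Rd d => gevreyWeight s (-h) p.1 • synthesisCoeff φ χ p.1 p.2) 2 ≤
      eLpNorm (fun x => gevreyWeight s (-h) x • χ.toFun x) 2 *
        eLpNorm (fun x => gevreyWeight s h x • φ.toFun x) 2 := by
  rw [← ENNReal.pow_le_pow_left_iff two_ne_zero, mul_pow, eLpNorm_two_sq, eLpNorm_two_sq,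
    eLpNorm_two_sq]
  have hmeas : Continuous fun p : Rd d × Rd d =>
      gevreyWeight s (-h) p.1 • synthesisCoeff φ χ p.1 p.2 :=
    ((continuous_gevreyWeight (by positivity) _).comp continuous_fst).smul
      (continuous_synthesisCoeff φ χ)
  calc ∫⁻ p : Rd d × Rd d, ‖gevreyWeight s (-h) p.1 • synthesisCoeff φ χ p.1 p.2‖ₑ ^ 2
      = ∫⁻ x, ∫⁻ ξ, ‖gevreyWeight s (-h) x • synthesisCoeff φ χ x ξ‖ₑ ^ 2 := by
        rw [Measure.volume_eq_prod, lintegral_prod]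
        exact (hmeas.enorm.measurable.pow_const 2).aemeasurable
    _ = ∫⁻ x, ∫⁻ y, ‖gevreyWeight s (-h) x • (χ.toFun y * φ.toFun (y - x))‖ₑ ^ 2 := by
        congr 1 with x
        simp only [enorm_smul, mul_pow]
        rw [lintegral_const_mul' _ _ (ENNReal.pow_ne_top enorm_ne_top),
          lintegral_const_mul' _ _ (ENNReal.pow_ne_top enorm_ne_top),
          lintegral_enorm_sq_synthesisCoeff]
    _ ≤ _ := lintegral_enorm_sq_gevreyWeight_neg_smul_mul_translate_le hs hh
        χ.continuous.measurable φ.continuous.measurable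

theorem enorm_integral_norm_sq_mul_apply_le (hs : 1 ≤ s) (hh : 0 ≤ h) (φ χ : Sigma1 d)
    (u : Sigma1Dual d) :
    ‖((∫ x, ‖φ.toFun x‖ ^ 2 : ℝ) : ℂ) * u χ‖ₑ ≤
      eLpNorm (fun x => gevreyWeight s (-h) x • χ.toFun x) 2 *
        eLpNorm (fun x => gevreyWeight s h x • φ.toFun x) 2 *
        eLpNorm (fun p : Rd d × Rd d => gevreyWeight s h p.1 • stft φ u p.1 p.2) 2 := by
  have hw (k : ℝ) : Continuous fun p : Rd d × Rd d => gevreyWeight s k p.1 :=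
    (continuous_gevreyWeight (by positivity) _).comp continuous_fst
  have hcoeff : AEStronglyMeasurable fun p : Rd d × Rd d =>
      gevreyWeight s (-h) p.1 • synthesisCoeff φ χ p.1 p.2 :=
    ((hw _).smul (continuous_synthesisCoeff φ χ)).aestronglyMeasurable
  have hstft : AEStronglyMeasurable fun p : Rd d × Rd d =>
      gevreyWeight s h p.1 • stft φ u p.1 p.2 :=
    ((hw _).smul (continuous_stft φ u)).aestronglyMeasurable
  have hcancel (p : Rd d × Rd d) : (gevreyWeight s (-h) p.1 • synthesisCoeff φ χ p.1 p.2) *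
      (gevreyWeight s h p.1 • stft φ u p.1 p.2) =
        synthesisCoeff φ χ p.1 p.2 * stft φ u p.1 p.2 := by
    rw [smul_mul_smul_comm, gevreyWeight_neg_rate,
      inv_mul_cancel₀ (gevreyWeight_pos _ _ _).ne', one_smul]
  have hpair : ‖((∫ x, ‖φ.toFun x‖ ^ 2 : ℝ) : ℂ) * u χ‖ₑ ≤
      ∫⁻ p : Rd d × Rd d, ‖synthesisCoeff φ χ p.1 p.2 * stft φ u p.1 p.2‖ₑ := by
    rw [← integral_synthesisCoeff_mul_stft]
    exact enorm_integral_le_lintegral_enorm _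
  have hholder := lintegral_enorm_mul_le_eLpNorm_mul_eLpNorm hcoeff hstft
  simp only [hcancel] at hholder
  refine hpair.trans (hholder.trans ?_)
  gcongr
  exact eLpNorm_gevreyWeight_neg_smul_synthesisCoeff_le hs hh φ χ

theorem exists_norm_apply_le_norm_weightedL2 (hs : 1 ≤ s) (hh : 0 ≤ h) (hφ : φ ≠ 0)
    (hu : MemLp (fun p : Rd d × Rd d => gevreyWeight s h p.1 • stft φ u p.1 p.2) 2) :
    ∃ C, ∀ χ, ‖u χ‖ ≤ C * ‖Sigma1.weightedL2 hs (-h) χ‖ := by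
  have hQ := Sigma1.integral_norm_sq_pos hφ
  set Q := ∫ x, ‖φ.toFun x‖ ^ 2
  set B := eLpNorm (fun x => gevreyWeight s h x • φ.toFun x) 2
  set A := eLpNorm (fun p : Rd d × Rd d => gevreyWeight s h p.1 • stft φ u p.1 p.2) 2
  refine ⟨B.toReal * A.toReal / Q, fun χ => ?_⟩
  have hfin := ENNReal.mul_ne_top (ENNReal.mul_ne_top
    (χ.memLp_two_gevreyWeight_smul hs (-h)).2.ne (φ.memLp_two_gevreyWeight_smul hs h).2.ne) hu.2.ne
  have hbound := ENNReal.toReal_mono hfin (enorm_integral_norm_sq_mul_apply_le hs hh φ χ u)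
  have hnorm : ‖Sigma1.weightedL2 hs (-h) χ‖ =
      (eLpNorm (fun x => gevreyWeight s (-h) x • χ.toFun x) 2).toReal :=
    Lp.norm_toLp _ (χ.memLp_two_gevreyWeight_smul hs (-h))
  rw [toReal_enorm, norm_mul, Complex.norm_of_nonneg hQ.le, ENNReal.toReal_mul, ENNReal.toReal_mul,
    ← hnorm] at hbound
  rw [div_mul_eq_mul_div, le_div_iff₀ hQ, mul_comm]
  exact hbound.trans_eq (by ring)

theorem exists_represents_of_memLp_stft (hs : 1 ≤ s) (hh : 0 < h) (hφ : φ ≠ 0)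
    (hu : MemLp (fun p : Rd d × Rd d => gevreyWeight s h p.1 • stft φ u p.1 p.2) 2) :
    ∃ F : Rd d → ℂ, Represents F u ∧ Integrable fun x => gevreyWeight s (h / 2) x • F x := by
  obtain ⟨C, hC⟩ := exists_norm_apply_le_norm_weightedL2 hs hh.le hφ hu
  obtain ⟨g, hg, hgu⟩ := exists_memLp_two_integral_eq _ u.toLinearMap hC
  have hweighted : Integrable fun x => gevreyWeight s (-(h / 2)) x • g x :=
    memLp_one_iff_integrable.1 (hg.smul (memLp_two_gevreyWeight hs (half_pos hh)))
  have hpair (χ : Sigma1 d) : (fun x => g x * Sigma1.weightedL2 hs (-h) χ x) =ᵐ[volume]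
      fun x => (gevreyWeight s (-h) x • g x) * χ.toFun x := by
    filter_upwards [(χ.memLp_two_gevreyWeight_smul hs (-h)).coeFn_toLp] with x hx
    exact (congrArg (g x * ·) hx).trans (by simp only [smul_mul_assoc, mul_smul_comm])
  have hint (χ : Sigma1 d) : Integrable fun x => (gevreyWeight s (-h) x • g x) * χ.toFun x :=
    (hg.integrable_mul (Lp.memLp (Sigma1.weightedL2 hs (-h) χ))).congr (hpair χ)
  have hF : Integrable fun x => gevreyWeight s (h / 2) x • gevreyWeight s (-h) x • g x := by
    simpa only [smul_smul, ← gevreyWeight_add, show h / 2 + -h = -(h / 2) by ring] using hweighted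
  exact ⟨fun x => gevreyWeight s (-h) x • g x,
    ⟨(integrable_of_gevreyWeight_smul (by positivity) (half_pos hh).le hF).locallyIntegrable,
      fun χ => ⟨hint χ, (hgu χ).trans (integral_congr_ae (hpair χ))⟩⟩, hF⟩

theorem memLp_stft_fourier_of_mem_coorbit (hs : 0 ≤ s) (hu : u ∈ coorbit φ h s) :
    MemLp (fun p : Rd d × Rd d =>
      gevreyWeight s h p.1 • stft (Sigma1.fourier d φ) u.fourier p.1 p.2) 2 := by
  have hcont : Continuous fun p : Rd d × Rd d =>
      gevreyWeight s h p.1 • stft (Sigma1.fourier d φ) u.fourier p.1 p.2 :=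
    ((continuous_gevreyWeight hs h).comp continuous_fst).smul (continuous_stft _ _)
  have hsq (ξ : Rd d) : ‖gevreyWeight s h ξ‖ₑ ^ 2 = ENNReal.ofReal (gevreyWeight s (2 * h) ξ) := by
    rw [← ofReal_norm, norm_gevreyWeight, ← ENNReal.ofReal_pow (gevreyWeight_pos s h ξ).le,
      gevreyWeight_sq]
  have hstft (ξ x : Rd d) :
      ‖stft (Sigma1.fourier d φ) u.fourier ξ x‖ₑ = ‖stft φ u (-x) ξ‖ₑ := by
    rw [← ofReal_norm, ← ofReal_norm, norm_stft_eq_norm_stft_fourier φ u, neg_neg]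
  refine memLp_two_of_lintegral_enorm_sq_lt_top hcont.aestronglyMeasurable ?_
  rw [Measure.volume_eq_prod, lintegral_prod _ (hcont.enorm.measurable.pow_const 2).aemeasurable]
  calc ∫⁻ ξ, ∫⁻ x, ‖gevreyWeight s h ξ • stft (Sigma1.fourier d φ) u.fourier ξ x‖ₑ ^ 2
      = ∫⁻ ξ, (∫⁻ x, ‖stft φ u x ξ‖ₑ ^ 2) * ENNReal.ofReal (gevreyWeight s (2 * h) ξ) := by
        congr 1 with ξ
        simp only [enorm_smul, mul_pow, hstft, hsq]
        rw [lintegral_const_mul' _ _ ENNReal.ofReal_ne_top, mul_comm,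
          lintegral_neg_eq_self (fun x => ‖stft φ u x ξ‖ₑ ^ 2)]
    _ < ⊤ := hu

end Representation

/-! ### The three characterizations -/

section Characterization

variable {d : ℕ} {s h : ℝ} {f : Rd d → ℂ} {φ : Sigma1 d} {u : Sigma1Dual d}

theorem exists_weightBound_of_mem_roumieuGS (hs : 1 ≤ s) (hf : f ∈ roumieuGS d s) :
    ∃ h : ℝ, 0 < h ∧ WeightBound s h f ∧ WeightBound s h (𝓕 f) := by
  obtain ⟨hfs, H, hH, hgs⟩ := hf
  exact ⟨decayRate d s H, decayRate_pos d (by positivity) hH,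
    weightBound_of_gsNorm_lt_top hs hH hfs hgs⟩

theorem weightBound_of_mem_beurlingGS (hs : 1 ≤ s) (hh : 0 < h) (hf : f ∈ beurlingGS d s) :
    WeightBound s h f ∧ WeightBound s h (𝓕 f) := by
  obtain ⟨H, hH, rfl⟩ := exists_decayRate_eq d (s := s) (by positivity) hh
  exact weightBound_of_gsNorm_lt_top hs hH hf.1 (hf.2 H hH)

theorem GevreyIntegrable.mem_roumieuGS (hs : 1 < s) (hh : 0 < h) (hf : GevreyIntegrable s h f)
    (hfs : ContDiff ℝ ∞ f) : f ∈ roumieuGS d s :=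
  ⟨hfs, gsIndex d s h, by unfold gsIndex; positivity, hf.gsNorm_lt_top hs hh hfs⟩

theorem mem_beurlingGS_of_gevreyIntegrable (hs : 1 < s)
    (hf : ∀ h : ℝ, 0 < h → GevreyIntegrable s h f) (hfs : ContDiff ℝ ∞ f) :
    f ∈ beurlingGS d s := by
  refine ⟨hfs, fun H hH => ?_⟩
  obtain ⟨h, hh, rfl⟩ := exists_gsIndex_eq d (s := s) (by positivity) hH
  exact (hf h hh).gsNorm_lt_top hs hh hfs

theorem Represents.mem_coorbit_inter (hf : Represents f u) (hs : 1 ≤ s) (hh : 0 < h)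
    (hfw : WeightBound s h f) (hfw' : WeightBound s h (𝓕 f)) (φ : Sigma1 d) :
    u ∈ coorbit φ (h / 8) s ∩ fourierCoorbit φ (h / 8) s := by
  have hfg : GevreyIntegrable s (h / 2) f :=
    hfw.gevreyIntegrable hs (half_pos hh).le (half_lt_self hh) hf.1.aestronglyMeasurable hfw'
  convert hfg.mem_coorbit_inter hs (half_pos hh) hf φ using 3 <;> ring

theorem Sigma1.fourier_ne_zero (hφ : φ ≠ 0) : Sigma1.fourier d φ ≠ 0 :=
  (map_ne_zero_iff _ (Function.LeftInverse.injective Sigma1.fourierInv_fourier)).2 hφ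

theorem exists_represents_fourier_of_mem_coorbit (hs : 1 ≤ s) (hh : 0 < h) (hφ : φ ≠ 0)
    (hu : u ∈ coorbit φ h s) :
    ∃ F : Rd d → ℂ, Represents F u.fourier ∧ Integrable fun ξ => gevreyWeight s (h / 2) ξ • F ξ :=
  exists_represents_of_memLp_stft hs hh (Sigma1.fourier_ne_zero hφ)
    (memLp_stft_fourier_of_mem_coorbit (by positivity) hu)

theorem exists_represents_gevreyIntegrable (hs : 1 ≤ s) (hh : 0 < h) (hφ : φ ≠ 0)
    (hu : u ∈ coorbit φ h s ∩ fourierCoorbit φ h s) :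
    ∃ f : Rd d → ℂ, Represents f u ∧ ContDiff ℝ ∞ f ∧ GevreyIntegrable s (h / 2) f := by
  have hs0 : 0 < s := by positivity
  obtain ⟨F, hF, hFint⟩ := exists_represents_fourier_of_mem_coorbit hs hh hφ hu.1
  obtain ⟨G, hG, hGint⟩ := exists_represents_fourier_of_mem_coorbit hs hh hφ hu.2
  have hFi := integrable_of_gevreyWeight_smul hs0.le (half_pos hh).le hFint
  have hFG : G =ᵐ[volume] 𝓕 F := hG.ae_eq hφ (hF.fourier hFi)
  have hFg : GevreyIntegrable s (h / 2) F :=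
    ⟨hFint, hGint.congr (hFG.mono fun x hx => congrArg _ hx)⟩
  exact ⟨𝓕⁻ F, hF.fourierInv hFi, contDiff_fourierInv_of_gevreyWeight_smul hs0 (half_pos hh) hFint,
    hFg.fourierInv hs0.le (half_pos hh).le⟩

theorem exists_represents_forall_gevreyIntegrable (hs : 1 ≤ s) (hφ : φ ≠ 0)
    (hu : ∀ h : ℝ, 0 < h → u ∈ coorbit φ h s ∩ fourierCoorbit φ h s) :
    ∃ f : Rd d → ℂ, Represents f u ∧ ContDiff ℝ ∞ f ∧
      ∀ h : ℝ, 0 < h → GevreyIntegrable s h f := by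
  obtain ⟨f, hf, hfs, -⟩ := exists_represents_gevreyIntegrable hs one_pos hφ (hu 1 one_pos)
  refine ⟨f, hf, hfs, fun h hh => ?_⟩
  obtain ⟨g, hg, -, hgi⟩ :=
    exists_represents_gevreyIntegrable hs (mul_pos two_pos hh) hφ (hu (2 * h) (by positivity))
  rw [mul_div_cancel_left₀ h two_ne_zero] at hgi
  exact hgi.congr_ae (hg.ae_eq hφ hf)

end Characterization

end

theorem theorem2p5 (d : ℕ) (s : ℝ) (hs : 1 < s) (φ : Sigma1 d) (hφ : φ ≠ 0)
    (u : Sigma1Dual d) :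
    -- the Roumieu case
    [ ∃ f : Rd d → ℂ, Represents f u ∧ f ∈ roumieuGS d s,
      ∃ f : Rd d → ℂ, Represents f u ∧
        ∃ h : ℝ, 0 < h ∧ WeightBound s h f ∧ WeightBound s h (𝓕 f),
      ∃ h : ℝ, 0 < h ∧ u ∈ coorbit φ h s ∩ fourierCoorbit φ h s ].TFAE ∧
    -- the Beurling case
    [ ∃ f : Rd d → ℂ, Represents f u ∧ f ∈ beurlingGS d s,
      ∃ f : Rd d → ℂ, Represents f u ∧
        ∀ h : ℝ, 0 < h → WeightBound s h f ∧ WeightBound s h (𝓕 f),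
      ∀ h : ℝ, 0 < h → u ∈ coorbit φ h s ∩ fourierCoorbit φ h s ].TFAE := by
  have hs1 : 1 ≤ s := hs.le
  constructor
  · tfae_have 1 → 2 := fun ⟨f, hf, hfs⟩ => ⟨f, hf, exists_weightBound_of_mem_roumieuGS hs1 hfs⟩
    tfae_have 2 → 3 := fun ⟨f, hf, h, hh, hfw, hfw'⟩ =>
      ⟨h / 8, by positivity, hf.mem_coorbit_inter hs1 hh hfw hfw' φ⟩
    tfae_have 3 → 1 := fun ⟨h, hh, hu⟩ =>
      have ⟨f, hf, hfs, hfi⟩ := exists_represents_gevreyIntegrable hs1 hh hφ hu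
      ⟨f, hf, hfi.mem_roumieuGS hs (half_pos hh) hfs⟩
    tfae_finish
  · tfae_have 1 → 2 := fun ⟨f, hf, hfs⟩ =>
      ⟨f, hf, fun h hh => weightBound_of_mem_beurlingGS hs1 hh hfs⟩
    tfae_have 2 → 3 := fun ⟨f, hf, hfw⟩ h hh => by
      have hh8 : 0 < 8 * h := by positivity
      simpa only [mul_div_cancel_left₀ h (by norm_num : (8 : ℝ) ≠ 0)] using
        hf.mem_coorbit_inter hs1 hh8 (hfw _ hh8).1 (hfw _ hh8).2 φ
    tfae_have 3 → 1 := fun hu =>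
      have ⟨f, hf, hfs, hfi⟩ := exists_represents_forall_gevreyIntegrable hs1 hφ hu
      ⟨f, hf, mem_beurlingGS_of_gevreyIntegrable hs hfi hfs⟩
    tfae_finish
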